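/- Let $n>1$, let $F_n$ be the free group with basis $\mathcal A_n=\{a_1,\dots,a_n\}$, let $k\ge 0$ be an integer, and let $U$ be a finite list (repetitions allowed) of cyclically reduced words in $F_n$. Suppose that - $U$ is *minimal*: no automorphism of $F_n$ reduces the sum of the lengths of the words in $U$, where words are regarded up to conjugacy, i.e. the length of the image of a word is the length of its cyclic reduction; - $U$ is *diskbusting*: one cannot write $F_n=A*B$ with $A,B\neq\{1\}$ in such a way that each word in $U$ is conjugate into $A$ or into $B$; - $U$ is *$k$-regular*: each generator in $\mathcal A_n$ appears (with exponent $+1$ or $-1$) exactly $k$ times in total in the words of $U$. Then $U$ is *polygonal*: there exist polygonal disks $P_1,\dots,P_m$ (2-disks whose boundary is a cycle with at least one side), a side-pairing $\sim$ on them (a partition of all the sides into pairs, with a homeomorphism between the two sides of each pair), with resulting closed (possibly disconnected) surface $S=\coprod_i P_i/\!\sim$ and its induced cell structure, and an immersion (locally injective graph map) $S^{(1)}\to \mathrm{Cay}(F_n)/F_n$ to the bouquet of $n$ oriented circles labelled by $a_1,\dots,a_n$, such that (i) for each $i$ the composition $\partial P_i\to S^{(1)}\to \mathrm{Cay}(F_n)/F_n$,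 followed from a suitable vertex of $\partial P_i$, reads, letter by letter, a power $u^c$ with $c\neq0$ of a word $u$ in $U$; (ii) the Euler characteristic satisfies $\chi(S)<m$. -/

import Mathlib

namespace Polygonality

/-- The cyclic length of `w`: the length of its cyclic reduction, that is, the least length of a
conjugate of `w`. -/
def cyclicLength {n : ℕ} (w : FreeGroup (Fin n)) : ℕ :=
  (FreeGroup.reduceCyclically w.toWord).length

/-- The total cyclic length of a list of words. -/
def totalLength {n : ℕ} (U : List (FreeGroup (Fin n))) : ℕ :=
  (U.map cyclicLength).sum

/-- No automorphism of `F_n` reduces the total length of the list. Words matter only up to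
conjugacy, so after applying an automorphism each word is measured by its cyclic reduction. -/
def IsMinimal {n : ℕ} (U : List (FreeGroup (Fin n))) : Prop :=
  ∀ φ : FreeGroup (Fin n) ≃* FreeGroup (Fin n), totalLength U ≤ totalLength (U.map φ)

/-- `G = A ∗ B` as an internal free product of subgroups. -/
def IsInternalFreeProduct {G : Type*} [Group G] (A B : Subgroup G) : Prop :=
  Function.Bijective (Monoid.Coprod.lift A.subtype B.subtype)

/-- `u` has a conjugate lying in the subgroup `A`. -/
def ConjugateInto {G : Type*} [Group G] (u : G) (A : Subgroup G) : Prop :=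
  ∃ g : G, g * u * g⁻¹ ∈ A

/-- The group is not a free product of two nontrivial subgroups `A`, `B` such that each word of
the list is conjugate into `A` or into `B`. -/
def IsDiskbusting {G : Type*} [Group G] (U : List G) : Prop :=
  ¬ ∃ A B : Subgroup G, A ≠ ⊥ ∧ B ≠ ⊥ ∧ IsInternalFreeProduct A B ∧
    ∀ u ∈ U, ConjugateInto u A ∨ ConjugateInto u B

/-- The number of occurrences of the generator `a`, as `a` or as `a⁻¹`, in the words of `U`. -/
def occurrences {n : ℕ} (U : List (FreeGroup (Fin n))) (a : Fin n) : ℕ :=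
  (U.map fun u => u.toWord.countP fun x => x.1 = a).sum

/-- Each generator appears exactly `k` times in the list. -/
def IsRegularList {n : ℕ} (k : ℕ) (U : List (FreeGroup (Fin n))) : Prop :=
  ∀ a : Fin n, occurrences U a = k

/-- Finitely many polygonal disks `P_0, …, P_{m-1}`; the boundary of `P_i` is a cycle with
`sides i ≥ 1` sides, traversed in a fixed direction. -/
structure Disks where
  m : ℕ
  sides : Fin m → ℕ
  sides_pos : ∀ i, 0 < sides i

/-- The sides of all the disks: `⟨i, j⟩` is the `j`-th side of `P_i`. -/
abbrev Disks.Side (P : Disks) : Type := Σ i : Fin P.m, Fin (P.sides i)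

/-- The corners (vertices of the boundary cycles) of all the disks: `⟨i, j⟩` is the initial corner
of the `j`-th side of `P_i`, and its terminal corner is the next one around `P_i`. -/
abbrev Disks.Corner (P : Disks) : Type := Σ i : Fin P.m, Fin (P.sides i)

/-- A side together with one of its ends: `false` is the initial and `true` the terminal end with
respect to the chosen traversal of the boundary of the disk. -/
abbrev Disks.HalfSide (P : Disks) : Type := P.Side × Bool

/-- The corner at which a half-side is based. -/
def Disks.HalfSide.corner {P : Disks} : P.HalfSide → P.Corner
  | (⟨i, j⟩, false) => ⟨i, j⟩
  | (⟨i, j⟩, true) => ⟨i, finRotate (P.sides i) j⟩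

/-- A side-pairing: the sides are partitioned into pairs `{s, pair s}`, and for each pair a
homeomorphism between the two sides is chosen. Up to isotopy the homeomorphism is determined by
what it does to the ends: `rev s` says that it matches the initial end of `s` with the terminal
end of `pair s`; otherwise it matches initial ends with each other. -/
structure SidePairing (P : Disks) where
  pair : P.Side → P.Side
  pair_pair : ∀ s, pair (pair s) = s
  pair_ne : ∀ s, pair s ≠ s
  rev : P.Side → Bool
  rev_pair : ∀ s, rev (pair s) = rev s

namespace SidePairing

variable {P : Disks} (σ : SidePairing P)

/-- The half-side that is glued to a given one. -/
def mate (h : P.HalfSide) : P.HalfSide := (σ.pair h.1, xor h.2 (σ.rev h.1))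

/-- The vertices of the closed surface `S = ∐ P_i / ∼`: corners modulo the equivalence relation
generated by the gluing of sides. -/
def Vertex : Type :=
  Quot fun p q : P.Corner => ∃ h : P.HalfSide, h.corner = p ∧ (σ.mate h).corner = q

/-- The edges of `S`: sides modulo the pairing. -/
def Edge : Type := Quot fun s t : P.Side => σ.pair s = t

/-- The vertex of `S` at which a half-side is based. -/
def vertex (h : P.HalfSide) : σ.Vertex := Quot.mk _ h.corner

/-- The Euler characteristic of `S`, from its cell structure with the `P_i` as 2-cells. -/
noncomputable def eulerChar : ℤ := (Nat.card σ.Vertex : ℤ) - Nat.card σ.Edge + P.m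

end SidePairing

/-- The inverse of a letter; `(a, true)` stands for `a` and `(a, false)` for `a⁻¹`. -/
def invLetter {n : ℕ} (x : Fin n × Bool) : Fin n × Bool := (x.1, !x.2)

/-- A graph map from the 1-skeleton of `S` to the bouquet of `n` oriented circles
`Cay(F_n) / F_n`: each edge of `S` is sent homeomorphically onto one of the circles in one of the
two directions. It is recorded by the letter `letter s` that is read when the side `s` is
traversed from its initial to its terminal end; glued sides must define the same map. -/
structure BouquetMap (n : ℕ) {P : Disks} (σ : SidePairing P) where
  letter : P.Side → Fin n × Bool
  letter_pair : ∀ s, letter (σ.pair s) = if σ.rev s then invLetter (letter s) else letter s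

namespace BouquetMap

variable {n : ℕ} {P : Disks} {σ : SidePairing P} (f : BouquetMap n σ)

/-- The letter read when leaving the base vertex of a half-side along it. -/
def outgoing (h : P.HalfSide) : Fin n × Bool :=
  if h.2 then invLetter (f.letter h.1) else f.letter h.1

/-- Local injectivity: two half-edges of `S` based at the same vertex with the same image
coincide. (Half-edges of `S` are half-sides up to gluing.) -/
def IsImmersion : Prop :=
  ∀ h h' : P.HalfSide, σ.vertex h = σ.vertex h' → f.outgoing h = f.outgoing h' →
    h' = h ∨ h' = σ.mate h

/-- The sequence of letters read along the boundary of `P_i`. -/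
def boundaryWord (i : Fin P.m) : List (Fin n × Bool) :=
  List.ofFn fun j => f.letter ⟨i, j⟩

end BouquetMap

/-- The list `U` of cyclically reduced words is polygonal: there are a side-pairing on polygonal
disks `P_0, …, P_{m-1}`, with resulting closed surface `S`, and an immersion of the 1-skeleton of
`S` into the bouquet of circles, such that each boundary reads (from some base corner) a
nontrivial power of a word of `U`, and `χ(S) < m`. -/
def IsPolygonal {n : ℕ} (U : List (FreeGroup (Fin n))) : Prop :=
  ∃ (P : Disks) (σ : SidePairing P) (f : BouquetMap n σ),
    f.IsImmersion ∧
    (∀ i : Fin P.m, ∃ u ∈ U, ∃ c : ℤ, c ≠ 0 ∧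
      (f.boundaryWord i).IsRotated (u ^ c).toWord) ∧
    σ.eulerChar < P.m

end Polygonality

open Finset

set_option linter.unusedSectionVars false

/-! The Whitehead graph has the 2n letters as vertices. Each position in a word gives an edge,
joining the letter there to the inverse of the cyclically preceding letter. Regularity makes this
graph `k`-valent. Minimality, tested on Whitehead automorphisms, says that a set of letters
separating some `x` from `x⁻¹` is left by at least `k` edges (`IsMinimal.occurrences_le`). A set of
odd size always separates such a pair, so the constant weight `1/k` lies in Edmonds' perfect
matching polytope and is an average of perfect matchings `M_i` (`IsFractional.isDecomposable`).

All edges lie in equally many `M_i`. Hence for each generator the index set has a permutation under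
which the edge used at `a` and the edge used at `a⁻¹` come from the same occurrence of the generator
(`nonempty_matchingFamily`).

The surface is built from triples `(x, i, j)` such that `M_i` and `M_j` differ at `x`. These are
half-sides; exchanging `i` and `j` is the gluing, following the edge of `M_i` at `x` turns a corner,
and the permutations lead to the other end of a side. Boundaries then run along words of the list.
At a vertex of the surface the pair `{i, j}` is fixed, so a letter determines the half-edge and the
1-skeleton is immersed. Corners around a vertex alternate between edges of `M_i` and `M_j`, so there
are at least two, whence V ≤ E. Equality would make all matchings pair the letters in the same way.
The Whitehead graph would then split into pairs of letters; the cut inequality would force each pair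
to be `{x, x⁻¹}` and every word to be a power of a generator, contrary to diskbusting. -/

/-- Two maps from a finite type with equinumerous fibres differ by a permutation of the source. -/
theorem exists_perm_comp_eq {ι α : Type*} [Fintype ι] [DecidableEq α] (f g : ι → α)
    (h : ∀ c, #{i | f i = c} = #{i | g i = c}) : ∃ π : Equiv.Perm ι, ∀ i, g (π i) = f i := by
  have e : ∀ c, Nonempty ({i // f i = c} ≃ {i // g i = c}) := fun c =>
    Fintype.card_eq.1 (by simpa [Fintype.card_subtype] using h c)
  refine ⟨(Equiv.sigmaFiberEquiv f).symm.trans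
    ((Equiv.sigmaCongrRight fun c => (e c).some).trans (Equiv.sigmaFiberEquiv g)), fun i => ?_⟩
  exact ((e (f i)).some ⟨i, rfl⟩).2

/-! ### Fractional perfect matchings of multigraphs, and contraction of odd sets. -/

namespace Multigraph

variable {E V : Type} [Fintype E] [DecidableEq E] [Fintype V] [DecidableEq V]

/-- The edges with exactly one end in `S`, in the multigraph in which `e` joins `a e` to `b e`. -/
def cut (a b : E → V) (S : Finset V) : Finset E := {e | ¬ (a e ∈ S ↔ b e ∈ S)}

theorem mem_cut {a b : E → V} {S : Finset V} {e : E} :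
    e ∈ cut a b S ↔ ¬ (a e ∈ S ↔ b e ∈ S) := by simp [cut]

theorem cut_compl (a b : E → V) (S : Finset V) : cut a b Sᶜ = cut a b S := by
  ext e; simp only [mem_cut, mem_compl]; tauto

theorem mem_cut_singleton {a b : E → V} {v : V} {e : E} :
    e ∈ cut a b {v} ↔ a e ≠ b e ∧ (a e = v ∨ b e = v) := by
  simp only [mem_cut, mem_singleton]
  constructor
  · intro h
    refine ⟨fun h' => h (by rw [h']), ?_⟩
    tauto
  · rintro ⟨h, rfl | rfl⟩ h'
    · exact h (h'.1 rfl).symm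
    · exact h (h'.2 rfl)

/-- Weights in Edmonds' perfect matching polytope. -/
structure IsFractional (a b : E → V) (w : E → ℚ) : Prop where
  nonneg : ∀ e, 0 ≤ w e
  vertex : ∀ v, ∑ e ∈ cut a b {v}, w e = 1
  odd : ∀ S : Finset V, Odd #S → 1 ≤ ∑ e ∈ cut a b S, w e

/-- A perfect matching, as a set of edges. -/
structure IsPerfect (a b : E → V) (M : Finset E) : Prop where
  card_vertex : ∀ v, #(M ∩ cut a b {v}) = 1
  ne : ∀ e ∈ M, a e ≠ b e

/-- The weights are an average of perfect matchings. -/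
def IsDecomposable (a b : E → V) (w : E → ℚ) : Prop :=
  ∃ (ι : Type) (_ : Fintype ι) (_ : Nonempty ι) (M : ι → Finset E),
    (∀ i, IsPerfect a b (M i)) ∧
    ∀ e, a e ≠ b e → (#{i | e ∈ M i} : ℚ) = Fintype.card ι * w e

namespace IsFractional

variable {a b : E → V} {w : E → ℚ}

/-- The cut of the whole vertex set is empty, so the odd-cut inequality would read `1 ≤ 0`. -/
theorem even_card (h : IsFractional a b w) : Even (Fintype.card V) := by
  by_contra hV
  have := h.odd univ (by simpa using hV)
  have h0 : cut a b univ = ∅ := by ext; simp [mem_cut]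
  rw [h0] at this
  norm_num at this

theorem le_one (h : IsFractional a b w) {e : E} (he : a e ≠ b e) : w e ≤ 1 := by
  rw [← h.vertex (a e)]
  exact single_le_sum (f := w) (fun i _ => h.nonneg i) (mem_cut_singleton.2 ⟨he, Or.inl rfl⟩)

end IsFractional

section Contraction

/-- The quotient map that contracts `S` to a point. -/
def contract (S : Finset V) (v : V) : Option {v : V // v ∉ S} :=
  if h : v ∈ S then none else some ⟨v, h⟩

theorem contract_eq_none {S : Finset V} {v : V} : contract S v = none ↔ v ∈ S := by
  unfold contract; split <;> simp_all

theorem contract_eq_some {S : Finset V} {v : V} {x : {v : V // v ∉ S}} :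
    contract S v = some x ↔ v = x := by
  unfold contract
  split
  · simp only [reduceCtorEq, false_iff]
    rintro rfl
    exact x.2 ‹_›
  · simp [Subtype.ext_iff]

theorem contract_eq {S : Finset V} {u v : V} :
    contract S u = contract S v ↔ u = v ∨ (u ∈ S ∧ v ∈ S) := by
  by_cases hv : v ∈ S
  · rw [contract_eq_none.2 hv, contract_eq_none]
    constructor
    · tauto
    · rintro (rfl | h); exacts [hv, h.1]
  · rw [show contract S v = some ⟨v, hv⟩ from contract_eq_some.2 rfl, contract_eq_some]
    tauto

theorem cut_contract (a b : E → V) (S : Finset V) (T : Finset (Option {v : V // v ∉ S})) :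
    cut (contract S ∘ a) (contract S ∘ b) T = cut a b {v | contract S v ∈ T} := by
  ext e; simp [mem_cut]

theorem cut_contract_none (a b : E → V) (S : Finset V) :
    cut (contract S ∘ a) (contract S ∘ b) {none} = cut a b S := by
  rw [cut_contract]; congr 1; ext v; simp [contract_eq_none]

theorem cut_contract_some (a b : E → V) (S : Finset V) (x : {v : V // v ∉ S}) :
    cut (contract S ∘ a) (contract S ∘ b) {some x} = cut a b {x.1} := by
  rw [cut_contract]; congr 1; ext v; simp [contract_eq_some]

/-- Cuts of the quotient are cuts of preimages. Since the only nontrivial fibre is `S`, which is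
odd, preimages keep their parity; tightness of `S` is the star condition at the new vertex. -/
theorem IsFractional.contract {a b : E → V} {w : E → ℚ} (h : IsFractional a b w) {S : Finset V}
    (hS : Odd #S) (ht : ∑ e ∈ cut a b S, w e = 1) :
    IsFractional (contract S ∘ a) (contract S ∘ b) w where
  nonneg := h.nonneg
  vertex v := by
    cases v with
    | none => rw [cut_contract_none, ht]
    | some x => rw [cut_contract_some, h.vertex]
  odd T hT := by
    rw [cut_contract]
    refine h.odd _ ?_
    rw [card_eq_sum_card_fiberwise (f := Multigraph.contract S) (t := T)
      (fun v hv => by simpa using hv), odd_sum_iff_odd_card_odd, filter_true_of_mem]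
    · exact hT
    · intro t ht'
      cases t with
      | none =>
        convert hS using 2
        ext v
        simp only [mem_filter, mem_univ, true_and]
        exact ⟨fun h => contract_eq_none.1 h.2, fun h => by
          rw [contract_eq_none.2 h]; exact ⟨ht', rfl⟩⟩
      | some x =>
        convert odd_one
        rw [card_eq_one]
        refine ⟨x, ?_⟩
        ext v
        simp only [mem_filter, mem_univ, true_and, mem_singleton]
        exact ⟨fun h => contract_eq_some.1 h.2, fun h => by
          rw [contract_eq_some.2 h]; exact ⟨ht', rfl⟩⟩

theorem card_contract_lt {S : Finset V} (hS : 1 < #S) :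
    Fintype.card (Option {v : V // v ∉ S}) < Fintype.card V := by
  have h1 : Fintype.card {v : V // v ∉ S} = #Sᶜ := by
    rw [Fintype.card_subtype]; congr 1; ext; simp
  have := card_compl_add_card S
  rw [Fintype.card_option, h1]
  omega

/-- A decomposition after contracting `S`, in terms of the original multigraph. -/
theorem IsDecomposable.of_contract {a b : E → V} {w : E → ℚ} {S : Finset V}
    (h : IsDecomposable (contract S ∘ a) (contract S ∘ b) w) :
    ∃ (ι : Type) (_ : Fintype ι) (_ : Nonempty ι) (M : ι → Finset E),
      (∀ i, ∀ v ∉ S, #(M i ∩ cut a b {v}) = 1) ∧ (∀ i, #(M i ∩ cut a b S) = 1) ∧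
      (∀ i, ∀ e ∈ M i, a e ≠ b e ∧ (a e ∉ S ∨ b e ∉ S)) ∧
      ∀ e, a e ≠ b e → (a e ∉ S ∨ b e ∉ S) → (#{i | e ∈ M i} : ℚ) = Fintype.card ι * w e := by
  obtain ⟨ι, i1, i2, M, hM, hc⟩ := h
  refine ⟨ι, i1, i2, M, fun i v hv => ?_, fun i => ?_, fun i e he => ?_, fun e h1 h2 => hc e ?_⟩
  · rw [← cut_contract_some a b S ⟨v, hv⟩, (hM i).card_vertex]
  · rw [← cut_contract_none a b S, (hM i).card_vertex]
  · have := (hM i).ne e he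
    simp only [Function.comp_apply, ne_eq, contract_eq] at this
    tauto
  · simp only [Function.comp_apply, ne_eq, contract_eq]
    tauto

/-- Every matching of either family crosses the cut of `S` in exactly one edge. Indexed by `ι₁ ×
ι₂`, both families use a given cut edge equally often, so a permutation `π` aligns matchings with
the same crossing edge, and aligned matchings unite to perfect matchings. -/
theorem isDecomposable_of_contract {a b : E → V} {w : E → ℚ} {S : Finset V}
    (h1 : IsDecomposable (contract S ∘ a) (contract S ∘ b) w)
    (h2 : IsDecomposable (contract Sᶜ ∘ a) (contract Sᶜ ∘ b) w) : IsDecomposable a b w := by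
  obtain ⟨ι₁, _, _, M₁, hv₁, hS₁, hn₁, hc₁⟩ := h1.of_contract
  obtain ⟨ι₂, _, _, M₂, hv₂, hS₂, hn₂, hc₂⟩ := h2.of_contract
  simp only [cut_compl, mem_compl, not_not] at hv₂ hS₂ hn₂ hc₂
  choose f₁ hf₁ using fun i => card_eq_one.1 (hS₁ i)
  choose f₂ hf₂ using fun i => card_eq_one.1 (hS₂ i)
  simp only [Finset.ext_iff, mem_inter, mem_singleton] at hf₁ hf₂
  have c₁ : ∀ e, a e ≠ b e → (a e ∉ S ∨ b e ∉ S) →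
      (#{i : ι₁ × ι₂ | e ∈ M₁ i.1} : ℚ) = Fintype.card (ι₁ × ι₂) * w e := by
    intro e h h'
    have : ({i : ι₁ × ι₂ | e ∈ M₁ i.1} : Finset _) = ({i | e ∈ M₁ i} : Finset _) ×ˢ univ := by
      ext; simp
    rw [this, card_product, Fintype.card_prod, card_univ]
    push_cast
    rw [hc₁ e h h']; ring
  have c₂ : ∀ e, a e ≠ b e → (a e ∈ S ∨ b e ∈ S) →
      (#{i : ι₁ × ι₂ | e ∈ M₂ i.2} : ℚ) = Fintype.card (ι₁ × ι₂) * w e := by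
    intro e h h'
    have : ({i : ι₁ × ι₂ | e ∈ M₂ i.2} : Finset _) = univ ×ˢ ({i | e ∈ M₂ i} : Finset _) := by
      ext; simp
    rw [this, card_product, Fintype.card_prod, card_univ]
    push_cast
    rw [hc₂ e h h']; ring
  have hcut : ∀ e ∈ cut a b S, a e ≠ b e ∧ (a e ∉ S ∨ b e ∉ S) ∧ (a e ∈ S ∨ b e ∈ S) := by
    intro e he
    rw [mem_cut] at he
    refine ⟨fun h => he (by rw [h]), ?_, ?_⟩ <;> tauto
  have e₁ : ∀ i e, e ∈ cut a b S → (e ∈ M₁ i ↔ f₁ i = e) := fun i e he =>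
    ⟨fun h => ((hf₁ i e).1 ⟨h, he⟩).symm, fun h => ((hf₁ i e).2 h.symm).1⟩
  have e₂ : ∀ i e, e ∈ cut a b S → (e ∈ M₂ i ↔ f₂ i = e) := fun i e he =>
    ⟨fun h => ((hf₂ i e).1 ⟨h, he⟩).symm, fun h => ((hf₂ i e).2 h.symm).1⟩
  obtain ⟨π, hπ⟩ := exists_perm_comp_eq (fun i : ι₁ × ι₂ => f₁ i.1) (fun i => f₂ i.2) (by
    intro e
    by_cases he : e ∈ cut a b S
    · obtain ⟨h, h', h''⟩ := hcut e he
      have := (c₁ e h h').trans (c₂ e h h'').symm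
      simp only [e₁ _ e he, e₂ _ e he] at this
      exact_mod_cast this
    · rw [filter_false_of_mem, filter_false_of_mem]
      · rintro i - rfl; exact he ((hf₂ i.2 _).2 rfl).2
      · rintro i - rfl; exact he ((hf₁ i.1 _).2 rfl).2)
  have key : ∀ i e, e ∈ cut a b S → (e ∈ M₁ i.1 ↔ e ∈ M₂ (π i).2) := fun i e he => by
    rw [e₁ _ e he, e₂ _ e he, hπ]
  refine ⟨ι₁ × ι₂, inferInstance, inferInstance, fun i => M₁ i.1 ∪ M₂ (π i).2,
    fun i => ⟨fun v => ?_, fun e he => ?_⟩, fun e he => ?_⟩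
  · by_cases hv : v ∈ S
    · rw [← hv₂ (π i).2 v hv]
      congr 1
      ext e
      simp only [mem_inter, mem_union]
      refine ⟨fun ⟨h, h'⟩ => ⟨?_, h'⟩, fun ⟨h, h'⟩ => ⟨Or.inr h, h'⟩⟩
      rcases h with h | h
      · refine (key i e ?_).1 h
        have := hn₁ _ e h
        rw [mem_cut_singleton] at h'
        rw [mem_cut]
        rcases h' with ⟨-, rfl | rfl⟩ <;> tauto
      · exact h
    · rw [← hv₁ i.1 v hv]
      congr 1
      ext e
      simp only [mem_inter, mem_union]
      refine ⟨fun ⟨h, h'⟩ => ⟨?_, h'⟩, fun ⟨h, h'⟩ => ⟨Or.inl h, h'⟩⟩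
      rcases h with h | h
      · exact h
      · refine (key i e ?_).2 h
        have := hn₂ _ e h
        rw [mem_cut_singleton] at h'
        rw [mem_cut]
        rcases h' with ⟨-, rfl | rfl⟩ <;> tauto
  · rcases mem_union.1 he with h | h
    exacts [(hn₁ _ e h).1, (hn₂ _ e h).1]
  · by_cases h1 : a e ∉ S ∨ b e ∉ S
    · rw [← c₁ e he h1]
      congr 2
      ext i
      simp only [mem_filter, mem_univ, true_and, mem_union, or_iff_left_iff_imp]
      intro h
      refine (key i e ?_).2 h
      have := hn₂ _ e h
      rw [mem_cut]
      tauto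
    -- An edge inside `S` occurs only in the second family, whose count is unchanged by reindexing
    -- along `π`.
    · have h2 : a e ∈ S ∨ b e ∈ S := by tauto
      rw [← c₂ e he h2]
      norm_cast
      refine card_bij (fun i _ => π i) ?_ (fun _ _ _ _ h => π.injective h) ?_
      · intro i hi
        simp only [mem_filter, mem_univ, true_and, mem_union] at hi ⊢
        exact hi.resolve_left fun h => h1 (hn₁ _ e h).2
      · intro i hi
        refine ⟨π.symm i, ?_, by simp⟩
        simp only [mem_filter, mem_univ, true_and, mem_union] at hi ⊢
        right; simpa using hi

end Contraction

/-- Convex combinations of a decomposable weight and a perfect matching are decomposable. -/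
theorem IsDecomposable.combine {a b : E → V} {w w' : E → ℚ} (h : IsDecomposable a b w')
    {M : Finset E} (hM : IsPerfect a b M) {t : ℚ} (h0 : 0 ≤ t) (h1 : t < 1)
    (hw : ∀ e, w e = (1 - t) * w' e + t * if e ∈ M then 1 else 0) : IsDecomposable a b w := by
  obtain ⟨ι, _, _, N, hN, hc⟩ := h
  obtain ⟨p, hp⟩ := Int.eq_ofNat_of_zero_le (Rat.num_nonneg.2 h0)
  have ht : t = p / t.den := by
    rw [← Int.cast_natCast p]; erw [← hp]; exact (Rat.num_div_den t).symm
  have hd : (0 : ℚ) < t.den := by exact_mod_cast t.den_pos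
  -- With `t = p / (p + r + 1)`, the mixture is realised by `r + 1` copies of the family together
  -- with `p * |ι|` copies of `M`.
  obtain ⟨r, hr⟩ : ∃ r, t.den = p + r + 1 := by
    have : (p : ℚ) < t.den := by
      rw [ht, div_lt_one hd] at h1; exact h1
    exact ⟨t.den - p - 1, by have : p < t.den := by exact_mod_cast this
                             omega⟩
  rw [hr] at ht
  push_cast at ht
  have hd' : ((p : ℚ) + r + 1) ≠ 0 := by positivity
  refine ⟨(Fin (r + 1) × ι) ⊕ (Fin p × ι), inferInstance, inferInstance,
    Sum.elim (fun i => N i.2) (fun _ => M), ?_, fun e he => ?_⟩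
  · rintro (i | i)
    exacts [hN _, hM]
  · have e1 : #{i : (Fin (r + 1) × ι) ⊕ (Fin p × ι) | e ∈ Sum.elim (fun i => N i.2) (fun _ => M) i}
        = (r + 1) * #{i | e ∈ N i} + p * Fintype.card ι * if e ∈ M then 1 else 0 := by
      rw [card_filter, Fintype.sum_sum_type]
      congr 1
      · rw [Fintype.sum_prod_type, card_filter]
        refine (sum_const (s := (univ : Finset (Fin (r + 1))))
          (∑ y, if e ∈ N y then 1 else 0)).trans ?_
        rw [card_univ, Fintype.card_fin, smul_eq_mul]
      · by_cases h : e ∈ M <;> simp [h]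
    rw [e1]
    push_cast
    rw [hc e he, hw, Fintype.card_sum, Fintype.card_prod, Fintype.card_prod, ht]
    simp only [Fintype.card_fin]
    push_cast
    field_simp
    ring
end Multigraph

/-! ### Edmonds' theorem, from Tutte's theorem and induction. -/

namespace Multigraph

variable {E V : Type} [Fintype E] [DecidableEq E] [Fintype V] [DecidableEq V]

/-- The simple graph of the edges of positive weight. -/
def support (a b : E → V) (w : E → ℚ) : SimpleGraph V where
  Adj u v := u ≠ v ∧ ∃ e, 0 < w e ∧ s(a e, b e) = s(u, v)
  symm := ⟨fun _ _ ⟨h, e, h1, h2⟩ => ⟨h.symm, e, h1, h2.trans Sym2.eq_swap⟩⟩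
  loopless := ⟨fun _ h => h.1 rfl⟩

/-- Each odd component left after deleting `u` has cut weight at least `1`, and all of it goes to
`u`, whose vertices can absorb only `1` each. So there are at most `|u|` odd components. -/
theorem IsFractional.not_isTutteViolator {a b : E → V} {w : E → ℚ} (h : IsFractional a b w)
    (u : Set V) : ¬ (support a b w).IsTutteViolator u := by
  classical
  intro hu
  unfold SimpleGraph.IsTutteViolator at hu
  set K := (⊤ : (support a b w).Subgraph).deleteVerts u with hK
  have hKv : ∀ v, v ∈ K.verts ↔ v ∉ u := by simp [hK]
  let S : K.coe.ConnectedComponent → Finset V := fun c =>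
    {v | ∃ hv : v ∈ K.verts, K.coe.connectedComponentMk ⟨v, hv⟩ = c}
  have hS : ∀ c v, v ∈ S c ↔ ∃ hv : v ∈ K.verts, K.coe.connectedComponentMk ⟨v, hv⟩ = c := by
    simp [S]
  have hcard : ∀ c, #(S c) = c.supp.ncard := by
    intro c
    rw [← Set.ncard_image_of_injective c.supp Subtype.val_injective, ← Set.ncard_coe_finset]
    congr 1
    ext v
    simp only [mem_coe, hS, Set.mem_image, SimpleGraph.ConnectedComponent.mem_supp_iff,
      Subtype.exists, exists_and_right, exists_eq_right]
  have hne : ∀ x y c e, 0 < w e → s(a e, b e) = s(x, y) → x ∈ S c → y ∉ S c → y ∈ u := by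
    intro x y c e he hxy hx hy
    by_contra hyu
    obtain ⟨hxK, hxc⟩ := (hS c x).1 hx
    refine hy ((hS c y).2 ⟨(hKv y).2 hyu, ?_⟩)
    rw [← hxc, SimpleGraph.ConnectedComponent.eq]
    refine SimpleGraph.Adj.reachable (SimpleGraph.Adj.symm ?_)
    have hxu := (hKv x).1 hxK
    have : (support a b w).Adj x y := ⟨fun h => hy (h ▸ hx), e, he, hxy⟩
    simp [hK, this, hxu, hyu]
  have huS : ∀ x c, x ∈ u → x ∉ S c := by
    intro x c hx hxc
    obtain ⟨hxK, -⟩ := (hS c x).1 hxc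
    exact (hKv x).1 hxK hx
  have hend : ∀ e c, 0 < w e → e ∈ cut a b (S c) →
      (a e ∈ S c ∧ b e ∈ u) ∨ (b e ∈ S c ∧ a e ∈ u) := by
    intro e c he hc
    rw [mem_cut] at hc
    by_cases h1 : a e ∈ S c
    · have h2 : b e ∉ S c := by tauto
      exact Or.inl ⟨h1, hne _ _ c e he rfl h1 h2⟩
    · have h2 : b e ∈ S c := by tauto
      exact Or.inr ⟨h2, hne _ _ c e he Sym2.eq_swap h2 h1⟩
  have hSu : ∀ x c c', x ∈ S c → x ∈ S c' → c = c' := by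
    intro x c c' hx hx'
    obtain ⟨_, h1⟩ := (hS c x).1 hx
    obtain ⟨_, h2⟩ := (hS c' x).1 hx'
    exact h1.symm.trans h2
  set O := K.coe.oddComponents.toFinset with hO
  -- Double counting: an edge of positive weight is in the cut of at most one component, and then it
  -- is in the star of a vertex of `u`.
  have hle : ∑ c ∈ O, ∑ e ∈ cut a b (S c), w e ≤ ∑ v ∈ u.toFinset, ∑ e ∈ cut a b {v}, w e := by
    have e1 : ∀ (α : Type) (s : Finset α) (f : α → Finset E),
        ∑ c ∈ s, ∑ e ∈ f c, w e = ∑ e, #{c ∈ s | e ∈ f c} * w e := by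
      intro α s f
      have : ∀ c, ∑ e ∈ f c, w e = ∑ e, if e ∈ f c then w e else 0 := fun c => by simp
      simp_rw [this]
      rw [sum_comm]
      refine sum_congr rfl fun e _ => ?_
      rw [← sum_filter, sum_const, nsmul_eq_mul]
    rw [e1, e1]
    refine sum_le_sum fun e _ => ?_
    rcases (h.nonneg e).eq_or_lt with h0 | h0
    · rw [← h0]; simp
    refine mul_le_mul_of_nonneg_right ?_ h0.le
    norm_cast
    rcases ({c ∈ O | e ∈ cut a b (S c)} : Finset _).eq_empty_or_nonempty with hem | ⟨c, hc⟩
    · rw [hem]; simp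
    have hc' := (mem_filter.1 hc).2
    have hab : a e ≠ b e := by
      intro h; rw [mem_cut, h] at hc'; exact hc' Iff.rfl
    refine le_trans (b := 1) (card_le_one.2 ?_) (card_pos.2 ?_)
    · intro c1 h1 c2 h2
      have h1 := (mem_filter.1 h1).2
      have h2 := (mem_filter.1 h2).2
      rcases hend e c1 h0 h1 with ⟨p, q⟩ | ⟨p, q⟩ <;> rcases hend e c2 h0 h2 with ⟨p', q'⟩ | ⟨p', q'⟩
      · exact hSu _ _ _ p p'
      · exact absurd p (huS _ _ q')
      · exact absurd p (huS _ _ q')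
      · exact hSu _ _ _ p p'
    · rcases hend e c h0 hc' with ⟨p, q⟩ | ⟨p, q⟩
      · exact ⟨b e, by simp [q, mem_cut_singleton, hab]⟩
      · exact ⟨a e, by simp [q, mem_cut_singleton, hab]⟩
  have h1 : (#O : ℚ) ≤ ∑ c ∈ O, ∑ e ∈ cut a b (S c), w e := by
    rw [← nsmul_one, ← sum_const]
    refine sum_le_sum fun c hc => h.odd _ ?_
    rw [hcard]
    simpa [hO] using hc
  have h2 : ∑ v ∈ u.toFinset, ∑ e ∈ cut a b {v}, w e = #u.toFinset := by
    rw [sum_congr rfl fun v _ => h.vertex v]; simp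
  rw [h2] at hle
  have h3 : #O ≤ #u.toFinset := by exact_mod_cast h1.trans hle
  rw [hO, ← Set.ncard_eq_toFinset_card', ← Set.ncard_eq_toFinset_card'] at h3
  omega

theorem IsFractional.exists_isPerfect {a b : E → V} {w : E → ℚ} (h : IsFractional a b w) :
    ∃ M, IsPerfect a b M ∧ ∀ e ∈ M, 0 < w e := by
  classical
  obtain ⟨M, hM, hsp⟩ := SimpleGraph.tutte.2 h.not_isTutteViolator
  -- One representative is fixed for each pair of ends, so that parallel edges are not both
  -- selected; `Option` covers the pairs that are not edges.
  have hex : ∀ s : Sym2 V, ∃ e : Option E, s ∈ M.edgeSet → ∃ e' ∈ e, 0 < w e' ∧ s(a e', b e') = s := by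
    intro s
    by_cases hs : s ∈ M.edgeSet
    · induction s with | _ x y =>
      obtain ⟨-, e, h1, h2⟩ := M.adj_sub (SimpleGraph.Subgraph.mem_edgeSet.1 hs)
      exact ⟨some e, fun _ => ⟨e, rfl, h1, h2⟩⟩
    · exact ⟨none, fun h => absurd h hs⟩
  choose f hf using hex
  let N : Finset E := {e | s(a e, b e) ∈ M.edgeSet ∧ f s(a e, b e) = some e}
  have hN : ∀ e, e ∈ N ↔ s(a e, b e) ∈ M.edgeSet ∧ f s(a e, b e) = some e := by simp [N]
  refine ⟨N, ⟨fun v => ?_, fun e he => ?_⟩, fun e he => ?_⟩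
  · obtain ⟨y, hy, hyu⟩ := hM (hsp v)
    obtain ⟨e, he, -, hs⟩ := hf s(v, y) hy
    rw [card_eq_one]
    refine ⟨e, ?_⟩
    ext e'
    rw [mem_inter, hN, mem_singleton, mem_cut_singleton]
    constructor
    · rintro ⟨⟨h1, h2⟩, h3, h4⟩
      have : s(a e', b e') = s(v, y) := by
        rcases h4 with rfl | rfl
        · exact congrArg (fun z => s(a e', z)) (hyu _ h1)
        · rw [Sym2.eq_swap] at h1 ⊢
          exact congrArg (fun z => s(b e', z)) (hyu _ h1)
      rw [this] at h2
      exact (Option.some.inj (he.symm.trans h2)).symm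
    · rintro rfl
      rw [hs]
      refine ⟨⟨hy, he⟩, ?_⟩
      have hvy : v ≠ y := (M.adj_sub hy).ne
      rcases Sym2.eq_iff.1 hs with ⟨h1, h2⟩ | ⟨h1, h2⟩ <;> rw [h1, h2]
      · exact ⟨hvy, Or.inl rfl⟩
      · exact ⟨hvy.symm, Or.inr rfl⟩
  · exact (M.adj_sub (SimpleGraph.Subgraph.mem_edgeSet.1 ((hN e).1 he).1)).ne
  · obtain ⟨h1, h2⟩ := (hN e).1 he
    obtain ⟨e', h3, h4, -⟩ := hf _ h1
    rw [h2] at h3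
    rwa [Option.some.inj h3]

/-- Moving away from a perfect matching as far as possible inside the polytope. -/
theorem IsFractional.exists_step {a b : E → V} {w : E → ℚ} (h : IsFractional a b w)
    {M : Finset E} (hM : IsPerfect a b M) (hpos : ∀ e ∈ M, 0 < w e) (hne : M.Nonempty)
    (hnt : ∀ S : Finset V, Odd #S → 1 < #S → 1 < #Sᶜ → ∑ e ∈ cut a b S, w e ≠ 1)
    (hdec : ¬ IsDecomposable a b w) :
    ∃ t : ℚ, 0 < t ∧ t < 1 ∧ ∃ w' : E → ℚ, IsFractional a b w' ∧
      (∀ e, w e = (1 - t) * w' e + t * if e ∈ M then 1 else 0) ∧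
      ((∃ e, w e ≠ 0 ∧ w' e = 0) ∨
        ∃ S : Finset V, Odd #S ∧ 1 < #S ∧ 1 < #Sᶜ ∧ ∑ e ∈ cut a b S, w' e = 1) := by
  -- Only odd cuts met more than once by `M` become tighter as `M` is subtracted; `g S` below is the
  -- value of `t` at which the inequality for `S` becomes an equality.
  let C : Finset (Finset V) := {S | Odd #S ∧ 1 < #(M ∩ cut a b S)}
  have hC : ∀ S ∈ C, Odd #S ∧ 1 < #S ∧ 1 < #Sᶜ ∧ 1 < #(M ∩ cut a b S) := by
    intro S hS
    obtain ⟨h1, h2⟩ := (mem_filter.1 hS).2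
    have key : ∀ T : Finset V, cut a b T = cut a b S → 1 < #T := by
      intro T hT
      by_contra hlt
      rw [← hT] at h2
      rcases Nat.le_one_iff_eq_zero_or_eq_one.1 (not_lt.1 hlt) with h0 | h0
      · rw [card_eq_zero] at h0
        have : cut a b T = ∅ := by ext; simp [mem_cut, h0]
        rw [this] at h2; simp at h2
      · obtain ⟨v, rfl⟩ := card_eq_one.1 h0
        rw [hM.card_vertex] at h2; omega
    exact ⟨h1, key S rfl, key Sᶜ (cut_compl a b S), h2⟩
  let g : Finset V → ℚ := fun S => (∑ e ∈ cut a b S, w e - 1) / (#(M ∩ cut a b S) - 1)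
  obtain ⟨t, htB, hmin⟩ := (M.image w ∪ C.image g).exists_min_image id
    ((hne.image w).mono subset_union_left)
  simp only [id] at hmin
  have htw : ∀ e ∈ M, t ≤ w e := fun e he => hmin _ (mem_union_left _ (mem_image_of_mem w he))
  have htg : ∀ S ∈ C, t ≤ g S := fun S hS => hmin _ (mem_union_right _ (mem_image_of_mem g hS))
  have hden : ∀ S ∈ C, (0 : ℚ) < #(M ∩ cut a b S) - 1 := by
    intro S hS
    have : (1 : ℚ) < #(M ∩ cut a b S) := by exact_mod_cast (hC S hS).2.2.2
    linarith
  have ht0 : 0 < t := by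
    rcases mem_union.1 htB with ht | ht
    · obtain ⟨e, he, rfl⟩ := mem_image.1 ht
      exact hpos e he
    · obtain ⟨S, hS, rfl⟩ := mem_image.1 ht
      obtain ⟨h1, h2, h3, h4⟩ := hC S hS
      refine div_pos ?_ (hden S hS)
      have := lt_of_le_of_ne (h.odd S h1) (hnt S h1 h2 h3).symm
      linarith
  -- If `t ≥ 1`, all edges of `M` have weight `1`; the star conditions then kill every other
  -- non-loop, and `M` alone is a decomposition.
  have ht1 : t < 1 := by
    by_contra hlt
    have hw1 : ∀ e ∈ M, w e = 1 := fun e he =>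
      le_antisymm (h.le_one (hM.ne e he)) ((not_lt.1 hlt).trans (htw e he))
    refine hdec ⟨Unit, inferInstance, inferInstance, fun _ => M, fun _ => hM, fun e he => ?_⟩
    by_cases heM : e ∈ M
    · simp [heM, hw1]
    · obtain ⟨f, hf⟩ := card_eq_one.1 (hM.card_vertex (a e))
      have hf' : f ∈ M ∩ cut a b {a e} := by rw [hf]; simp
      rw [mem_inter] at hf'
      have he' : e ∈ cut a b {a e} := mem_cut_singleton.2 ⟨he, Or.inl rfl⟩
      have hfe : f ≠ e := fun h => heM (h ▸ hf'.1)
      have hle : ∑ e ∈ {f, e}, w e ≤ 1 := by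
        rw [← h.vertex (a e)]
        refine sum_le_sum_of_subset_of_nonneg ?_ fun i _ _ => h.nonneg i
        intro x hx
        rw [mem_insert, mem_singleton] at hx
        rcases hx with rfl | rfl
        exacts [hf'.2, he']
      rw [sum_pair hfe, hw1 f hf'.1] at hle
      have := h.nonneg e
      have : w e = 0 := by linarith
      simp [heM, this]
  have h1t : 0 < 1 - t := by linarith
  let w' : E → ℚ := fun e => (w e - t * if e ∈ M then 1 else 0) / (1 - t)
  have hsum : ∀ s : Finset E, ∑ e ∈ s, w' e = (∑ e ∈ s, w e - t * #(M ∩ s)) / (1 - t) := by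
    intro s
    simp only [w']
    rw [← sum_div, sum_sub_distrib, ← mul_sum, sum_boole, inter_comm, filter_mem_eq_inter]
  refine ⟨t, ht0, ht1, w', ⟨fun e => ?_, fun v => ?_, fun S hS => ?_⟩, fun e => ?_, ?_⟩
  · refine div_nonneg ?_ h1t.le
    split
    · have := htw e ‹_›; linarith
    · have := h.nonneg e; linarith
  · rw [hsum, h.vertex, hM.card_vertex]
    field_simp
    simp
  · rw [hsum, le_div_iff₀ h1t]
    by_cases hSC : S ∈ C
    · have := htg S hSC
      simp only [g] at this
      rw [le_div_iff₀ (hden S hSC)] at this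
      linarith
    · have : #(M ∩ cut a b S) ≤ 1 := by
        by_contra hh
        exact hSC (mem_filter.2 ⟨mem_univ _, hS, not_le.1 hh⟩)
      have h2 : (#(M ∩ cut a b S) : ℚ) ≤ 1 := by exact_mod_cast this
      have := h.odd S hS
      nlinarith
  · simp only [w']; field_simp; ring
  · rcases mem_union.1 htB with ht | ht
    · obtain ⟨e, he, rfl⟩ := mem_image.1 ht
      exact Or.inl ⟨e, (hpos e he).ne', by simp [w', he]⟩
    · obtain ⟨S, hS, hg⟩ := mem_image.1 ht
      obtain ⟨h1, h2, h3, h4⟩ := hC S hS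
      refine Or.inr ⟨S, h1, h2, h3, ?_⟩
      have := hden S hS
      simp only [g] at hg
      rw [div_eq_iff this.ne'] at hg
      rw [hsum, div_eq_one_iff_eq h1t.ne']
      linarith

/-- **Edmonds' perfect matching polytope theorem**: a rational weight on the edges that gives
total weight `1` to each star and at least `1` to each odd cut is an average of perfect
matchings. -/
theorem IsFractional.isDecomposable {a b : E → V} {w : E → ℚ} (h : IsFractional a b w) :
    IsDecomposable a b w := by
  obtain ⟨n, hn⟩ : ∃ n, Fintype.card V = n := ⟨_, rfl⟩
  induction n using Nat.strong_induction_on generalizing V w with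
  | _ n ihV =>
  -- A tight odd cut with at least two vertices on each side finishes the proof, since both
  -- contractions have fewer vertices; the complement is odd because the vertex number is even.
  have tight : ∀ w : E → ℚ, IsFractional a b w → ∀ S : Finset V, Odd #S → 1 < #S → 1 < #Sᶜ →
      ∑ e ∈ cut a b S, w e = 1 → IsDecomposable a b w := by
    intro w h S h1 h2 h3 h4
    have h1' : Odd #Sᶜ := by
      have h5 := card_compl_add_card S
      have h6 := h.even_card
      rw [← h5, Nat.even_add'] at h6
      exact h6.2 h1
    refine isDecomposable_of_contract (S := S)
      (ihV _ ?_ (h.contract h1 h4) rfl) (ihV _ ?_ (h.contract h1' (by rwa [cut_compl])) rfl)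
    · rw [← hn]; exact card_contract_lt h2
    · rw [← hn]; exact card_contract_lt h3
  -- Inner induction on the size of the support: a step away from a matching either kills an edge or
  -- makes such an odd cut tight.
  obtain ⟨m, hm⟩ : ∃ m, #{e | w e ≠ 0} = m := ⟨_, rfl⟩
  induction m using Nat.strong_induction_on generalizing w with
  | _ m ihm =>
  by_contra hdec
  obtain ⟨M, hM, hpos⟩ := h.exists_isPerfect
  have hne : M.Nonempty := by
    rw [nonempty_iff_ne_empty]
    rintro rfl
    refine hdec ⟨Unit, inferInstance, inferInstance, fun _ => ∅, fun _ => hM, fun e _ => ?_⟩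
    have := hM.card_vertex (a e)
    simp at this
  obtain ⟨t, h0, h1, w', hw', hw, hcase⟩ := h.exists_step hM hpos hne
    (fun S h1 h2 h3 h4 => hdec (tight w h S h1 h2 h3 h4)) hdec
  refine hdec (IsDecomposable.combine (w' := w') ?_ hM h0.le h1 hw)
  rcases hcase with ⟨e, he, he'⟩ | ⟨S, h1, h2, h3, h4⟩
  · refine ihm _ ?_ hw' rfl
    rw [← hm]
    refine card_lt_card (ssubset_iff_of_subset ?_ |>.2 ⟨e, by simpa using he, by simpa using he'⟩)
    intro x hx
    simp only [mem_filter, mem_univ, true_and] at hx ⊢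
    rw [hw x]
    have h3 : 0 < w' x := lt_of_le_of_ne (hw'.nonneg x) (Ne.symm hx)
    have h4 : 0 < (1 - t) * w' x := mul_pos (by linarith) h3
    split <;> nlinarith
  · exact tight w' hw' S h1 h2 h3 h4

end Multigraph

/-! ### Cyclic length and Whitehead automorphisms. -/

namespace Polygonality

variable {n : ℕ}

@[simp] theorem invLetter_invLetter (x : Fin n × Bool) : invLetter (invLetter x) = x := by
  simp [invLetter]

theorem invLetter_ne (x : Fin n × Bool) : invLetter x ≠ x := by
  intro h
  have := congrArg Prod.snd h
  simp [invLetter] at this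

theorem cyclicLength_eq {w : FreeGroup (Fin n)} (h : FreeGroup.IsCyclicallyReduced w.toWord) :
    cyclicLength w = w.toWord.length := by
  unfold cyclicLength
  congr 1
  generalize w.toWord = L at h
  induction L using List.bidirectionalRec with
  | nil => simp
  | singleton a => simp
  | cons_append a L b ih =>
    rw [FreeGroup.reduceCyclically.cons_append, if_neg]
    · simp
    · rintro ⟨h1, h2⟩
      have := (FreeGroup.isCyclicallyReduced_cons_append_iff.1 (by simpa using h)).2 h1
      rw [this] at h2
      simp at h2

theorem norm_pow_le {α : Type*} [DecidableEq α] (v : FreeGroup α) (m : ℕ) :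
    (v ^ m).norm ≤ m * v.norm := by
  induction m with
  | zero => simp
  | succ m ih =>
    rw [pow_succ, Nat.succ_mul]
    exact (FreeGroup.norm_mul_le _ _).trans (by omega)

/-- The cyclic length is at most the length of any conjugate. -/
theorem cyclicLength_le_norm_conj (w g : FreeGroup (Fin n)) :
    cyclicLength w ≤ (g * w * g⁻¹).norm := by
  -- Compare lengths of powers: the length of `w ^ (m + 1)` grows at least at the rate `cyclicLength
  -- w`, while conjugation costs only the constant `2 * g.norm`.
  have key : ∀ m : ℕ, (m + 1) * cyclicLength w ≤
      2 * g.norm + (m + 1) * (g * w * g⁻¹).norm := by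
    intro m
    have h1 : (m + 1) * cyclicLength w ≤ (w ^ (m + 1)).norm := by
      rw [FreeGroup.norm, FreeGroup.toWord_pow,
        FreeGroup.reduceCyclically.reduce_flatten_replicate_succ FreeGroup.isReduced_toWord]
      simp only [List.length_append, List.length_flatten, List.map_replicate, List.sum_replicate,
        cyclicLength, smul_eq_mul]
      omega
    have h2 : w ^ (m + 1) = g⁻¹ * (g * w * g⁻¹) ^ (m + 1) * g := by
      rw [conj_pow]; group
    have h3 := FreeGroup.norm_mul_le (g⁻¹ * (g * w * g⁻¹) ^ (m + 1)) g
    have h4 := FreeGroup.norm_mul_le g⁻¹ ((g * w * g⁻¹) ^ (m + 1))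
    have h5 := norm_pow_le (g * w * g⁻¹) (m + 1)
    rw [← h2] at h3
    rw [FreeGroup.norm_inv_eq] at h4
    omega
  by_contra hlt
  have := key (2 * g.norm)
  nlinarith

theorem norm_of_zpow_le (a : Fin n) (s : ℤ) : (FreeGroup.of a ^ s).norm ≤ s.natAbs := by
  obtain ⟨m, rfl | rfl⟩ := s.eq_nat_or_neg
  · rw [zpow_natCast, FreeGroup.norm_of_pow]; simp
  · rw [zpow_neg, FreeGroup.norm_inv_eq, zpow_natCast, FreeGroup.norm_of_pow]; simp

/-- The homomorphism that fixes `a` and multiplies every other letter on both sides by powers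
of `a`. -/
def whiteheadHom (a : Fin n) (z : Fin n × Bool → ℤ) : FreeGroup (Fin n) →* FreeGroup (Fin n) :=
  FreeGroup.lift fun i => if i = a then FreeGroup.of a else
    FreeGroup.of a ^ (-z (i, true)) * FreeGroup.of i * FreeGroup.of a ^ z (i, false)

/-- As `a` is fixed, the exponents of the outer powers of `a` add up, so negating `z` inverts the
map. -/
theorem whiteheadHom_comp (a : Fin n) (z : Fin n × Bool → ℤ) :
    (whiteheadHom a (-z)).comp (whiteheadHom a z) = MonoidHom.id _ := by
  ext i
  have ha : ∀ z, whiteheadHom a z (FreeGroup.of a) = FreeGroup.of a := by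
    intro z; simp [whiteheadHom]
  by_cases hi : i = a
  · subst hi; simp [ha]
  · have h : ∀ z, whiteheadHom a z (FreeGroup.of i) =
        FreeGroup.of a ^ (-z (i, true)) * FreeGroup.of i * FreeGroup.of a ^ z (i, false) := by
      intro z; simp [whiteheadHom, hi]
    simp only [MonoidHom.comp_apply, h, map_mul, map_zpow, ha, MonoidHom.id_apply, Pi.neg_apply]
    group

/-- The automorphism given by `whiteheadHom`. -/
def whiteheadEquiv (a : Fin n) (z : Fin n × Bool → ℤ) : FreeGroup (Fin n) ≃* FreeGroup (Fin n) :=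
  MonoidHom.toMulEquiv (whiteheadHom a z) (whiteheadHom a (-z)) (whiteheadHom_comp a z)
    (by simpa using whiteheadHom_comp a (-z))

/-- The normalisation of `z` at `a` and `a⁻¹` lets these two letters obey the same formula as the
others, with trivial middle factor. -/
theorem whiteheadHom_letter {a : Fin n} {z : Fin n × Bool → ℤ} (ht : z (a, true) = 0)
    (hf : z (a, false) = 1) (x : Fin n × Bool) :
    whiteheadHom a z (FreeGroup.mk [x]) = FreeGroup.of a ^ (-z x) *
      (if x.1 = a then 1 else FreeGroup.mk [x]) * FreeGroup.of a ^ z (invLetter x) := by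
  obtain ⟨i, b⟩ := x
  have h1 : FreeGroup.mk [(i, true)] = FreeGroup.of i := rfl
  have h2 : FreeGroup.mk [(i, false)] = (FreeGroup.of i)⁻¹ := rfl
  by_cases hi : i = a
  · subst hi
    cases b
    · simp [h2, invLetter, whiteheadHom, ht, hf]
    · simp [h1, invLetter, whiteheadHom, ht, hf]
  · cases b
    · simp [h2, invLetter, whiteheadHom, hi, mul_assoc]
    · simp [h1, invLetter, whiteheadHom, hi]

/-- The powers of `a` between consecutive letters merge, leaving the difference of two values of
`z`; a middle factor costs `1` unless the letter is `a` or `a⁻¹`. Here `y 0` plays the letter before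
the word, and the word is `y 1, …, y j`. -/
theorem norm_whiteheadHom_le {a : Fin n} {z : Fin n × Bool → ℤ} (ht : z (a, true) = 0)
    (hf : z (a, false) = 1) (y : ℕ → Fin n × Bool) (j : ℕ) :
    (FreeGroup.of a ^ z (invLetter (y 0)) *
      whiteheadHom a z (FreeGroup.mk ((List.range j).map fun t => y (t + 1))) *
      FreeGroup.of a ^ (-z (invLetter (y j)))).norm ≤
    ∑ t ∈ range j, ((z (invLetter (y t)) - z (y (t + 1))).natAbs +
      if (y (t + 1)).1 = a then 0 else 1) := by
  induction j with
  | zero =>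
    rw [List.range_zero, List.map_nil, ← FreeGroup.one_eq_mk]
    simp
  | succ j ih =>
    rw [List.range_succ, List.map_append, ← FreeGroup.mul_mk, map_mul, sum_range_succ,
      List.map_singleton, whiteheadHom_letter ht hf]
    set W := whiteheadHom a z (FreeGroup.mk ((List.range j).map fun t => y (t + 1)))
    set m : FreeGroup (Fin n) := if (y (j + 1)).1 = a then 1 else FreeGroup.mk [y (j + 1)] with hm
    have h1 : m.norm ≤ if (y (j + 1)).1 = a then 0 else 1 := by
      rw [hm]; split
      · simp
      · exact FreeGroup.norm_mk_le
    have h2 := norm_of_zpow_le a (z (invLetter (y j)) - z (y (j + 1)))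
    have h3 : FreeGroup.of a ^ z (invLetter (y 0)) * (W * (FreeGroup.of a ^ (-z (y (j + 1))) * m *
        FreeGroup.of a ^ z (invLetter (y (j + 1))))) *
        FreeGroup.of a ^ (-z (invLetter (y (j + 1)))) =
        FreeGroup.of a ^ z (invLetter (y 0)) * W * FreeGroup.of a ^ (-z (invLetter (y j))) *
        (FreeGroup.of a ^ (z (invLetter (y j)) - z (y (j + 1))) * m) := by
      rw [zpow_sub]; group
    rw [h3]
    refine (FreeGroup.norm_mul_le _ _).trans (add_le_add ih ?_)
    exact (FreeGroup.norm_mul_le _ _).trans (add_le_add h2 h1)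

theorem cyclicLength_whiteheadHom_le {a : Fin n} {z : Fin n × Bool → ℤ} (ht : z (a, true) = 0)
    (hf : z (a, false) = 1) (u : FreeGroup (Fin n)) :
    cyclicLength (whiteheadHom a z u) ≤ ∑ t : Fin u.toWord.length,
      ((z (invLetter (u.toWord.get ((finRotate _).symm t))) - z (u.toWord.get t)).natAbs +
        if (u.toWord.get t).1 = a then 0 else 1) := by
  obtain ⟨L, hL⟩ : ∃ L, u.toWord = L := ⟨_, rfl⟩
  have hu : u = FreeGroup.mk L := by rw [← hL, FreeGroup.mk_toWord]
  rw [hL, hu]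
  clear hL hu
  obtain ⟨m, hm⟩ : ∃ m, L.length = m := ⟨_, rfl⟩
  rcases m with _ | m
  · rw [List.length_eq_zero_iff] at hm
    subst hm
    rw [← FreeGroup.one_eq_mk, map_one]
    simp [cyclicLength]
  · have hlt : ∀ t, t % L.length < L.length := fun t => Nat.mod_lt _ (by omega)
    -- Periodic extension shifted by one place, with `m = L.length - 1`: `y 0` is the last letter.
    -- Since `y L.length = y 0`, the outer powers of `a` form a conjugation, which cyclic length
    -- ignores.
    let y : ℕ → Fin n × Bool := fun t => L[(t + m) % L.length]'(hlt _)
    have hy1 : ∀ t (h : t < L.length), y (t + 1) = L[t] := by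
      intro t h
      simp only [y]
      congr 1
      rw [show t + 1 + m = t + L.length by omega, Nat.add_mod_right, Nat.mod_eq_of_lt h]
    have hy0 : y L.length = y 0 := by
      simp only [y]
      congr 1
      rw [Nat.add_mod_left, zero_add]
    have hmap : (List.range L.length).map (fun t => y (t + 1)) = L := by
      refine List.ext_getElem (by simp) fun t h1 h2 => ?_
      simp [hy1 t h2]
    have hyp : ∀ t : Fin L.length, L.get ((finRotate _).symm t) = y t := by
      intro t
      have : (finRotate L.length).symm t = ⟨(t + m) % L.length, hlt _⟩ := by
        rw [Equiv.symm_apply_eq]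
        have : NeZero L.length := ⟨by omega⟩
        rw [finRotate_apply]
        ext
        rw [Fin.val_add, Fin.val_one', Nat.mod_add_mod, Nat.add_mod_mod,
          show (t : ℕ) + m + 1 = t + L.length by omega, Nat.add_mod_right, Nat.mod_eq_of_lt t.2]
      rw [this]; rfl
    have key := norm_whiteheadHom_le ht hf y L.length
    rw [hmap, hy0, zpow_neg] at key
    refine (cyclicLength_le_norm_conj _ _).trans (key.trans (le_of_eq ?_))
    rw [Finset.sum_range]
    refine sum_congr rfl fun t _ => ?_
    rw [hyp, hy1 t t.2]; rfl

/-! ### Positions in cyclic words; consequences of minimality and diskbusting. -/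

/-- The positions of the letters in the words of the list. -/
abbrev Position (U : List (FreeGroup (Fin n))) : Type :=
  Σ i : Fin U.length, Fin (U.get i).toWord.length

namespace Position

variable {U : List (FreeGroup (Fin n))}

/-- The letter at a position. -/
def letter (p : Position U) : Fin n × Bool := (U.get p.1).toWord.get p.2

/-- The cyclically next position. -/
def next : Equiv.Perm (Position U) := Equiv.sigmaCongrRight fun _ => finRotate _

theorem next_mk (i : Fin U.length) (t : Fin (U.get i).toWord.length) :
    next (⟨i, t⟩ : Position U) = ⟨i, finRotate _ t⟩ := rfl

theorem letter_next_iterate (p : Position U) (j : ℕ) :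
    ((next ^[j] p).1 = p.1) ∧
    letter (next^[j] p) = (U.get p.1).toWord[(p.2 + j) % (U.get p.1).toWord.length]'(
      Nat.mod_lt _ (p.2.pos)) ∧
    (next^[j] p = p ↔ (U.get p.1).toWord.length ∣ j) := by
  obtain ⟨i, t⟩ := p
  have h : ∀ j, next^[j] (⟨i, t⟩ : Position U) = ⟨i, ⟨(t + j) % _, Nat.mod_lt _ t.pos⟩⟩ := by
    intro j
    induction j with
    | zero =>
      rw [Function.iterate_zero_apply]
      congr 1
      ext
      exact (Nat.mod_eq_of_lt t.2).symm
    | succ j ih =>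
      rw [Function.iterate_succ_apply', ih, next_mk]
      congr 1
      have : NeZero (U.get i).toWord.length := ⟨t.pos.ne'⟩
      rw [finRotate_apply]
      ext
      rw [Fin.val_add, Fin.val_one', Nat.mod_add_mod, Nat.add_mod_mod, add_assoc]
  rw [h j]
  refine ⟨rfl, rfl, ?_⟩
  rw [Sigma.mk.injEq]
  simp only [heq_eq_eq, true_and, Fin.ext_iff]
  conv_lhs => rhs; rw [← Nat.mod_eq_of_lt t.2]
  conv_lhs => rhs; rw [← add_zero (t : ℕ)]
  change (t : ℕ) + j ≡ t + 0 [MOD _] ↔ _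
  rw [Nat.ModEq.add_iff_left rfl, Nat.modEq_zero_iff_dvd]

theorem letter_next_ne (hred : ∀ u ∈ U, FreeGroup.IsCyclicallyReduced u.toWord) (p : Position U) :
    letter (next p) ≠ invLetter (letter p) := by
  obtain ⟨i, t⟩ := p
  obtain ⟨h1, h2⟩ := hred _ (List.get_mem U i)
  rw [next_mk]
  unfold letter
  dsimp only
  generalize (U.get i).toWord = L at *
  have : NeZero L.length := ⟨t.pos.ne'⟩
  rw [finRotate_apply]
  intro he
  by_cases hlast : t + 1 < L.length
  · have := List.isChain_iff_getElem.1 h1 t hlast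
    have he' : L[(t : ℕ) + 1] = invLetter L[(t : ℕ)] := by
      refine Eq.trans ?_ he
      rw [List.get_eq_getElem]
      congr 1
      rw [Fin.val_add, Fin.val_one', Nat.add_mod_mod, Nat.mod_eq_of_lt hlast]
    rw [he'] at this
    simp [invLetter] at this
  -- At the last position the successor is the first letter, and cyclic rather than ordinary
  -- reducedness is needed.
  · have e1 : L.getLast? = some (L.get t) := by
      rw [List.getLast?_eq_getElem?, List.getElem?_eq_getElem (by omega)]
      congr 2
      have := t.2
      omega
    have e2 : L.head? = some (L.get (t + 1)) := by
      rw [List.head?_eq_getElem?, List.getElem?_eq_getElem t.pos]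
      congr 2
      change 0 = ((t + 1 : Fin L.length) : ℕ)
      rw [Fin.val_add, Fin.val_one', Nat.add_mod_mod, show (t : ℕ) + 1 = L.length by omega,
        Nat.mod_self]
    have := h2 _ e1 _ e2
    rw [he] at this
    simp [invLetter] at this

theorem card_letter (U : List (FreeGroup (Fin n))) (a : Fin n) :
    #{p : Position U | (letter p).1 = a} = occurrences U a := by
  rw [card_filter, Fintype.sum_sigma, occurrences, ← Fin.sum_univ_fun_getElem]
  refine sum_congr rfl fun i _ => ?_
  have : ∀ L : List (Fin n × Bool), L.countP (fun x => x.1 = a) =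
      (L.map fun x => if x.1 = a then 1 else 0).sum := by
    intro L
    induction L with
    | nil => simp
    | cons x L ih => rw [List.countP_cons, ih]; simp [add_comm]
  rw [this, ← Fin.sum_univ_fun_getElem]
  rfl

end Position

open Position in
/-- In the Whitehead graph of a minimal list, a set of letters that separates a generator from its
inverse is left by at least as many edges as there are occurrences of the generator. -/
theorem IsMinimal.occurrences_le {U : List (FreeGroup (Fin n))} (hmin : IsMinimal U)
    (hred : ∀ u ∈ U, FreeGroup.IsCyclicallyReduced u.toWord) {a : Fin n}
    {X : Finset (Fin n × Bool)} (ht : (a, true) ∉ X) (hf : (a, false) ∈ X) :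
    occurrences U a ≤
      #{p : Position U | ¬ (letter p ∈ X ↔ invLetter (letter (next.symm p)) ∈ X)} := by
  -- For an indicator function, the merged power of `a` has length `1` exactly at the edges that
  -- leave `X`, while each occurrence of the generator is saved. Minimality says that the gain is at
  -- most the cost.
  let z : Fin n × Bool → ℤ := fun x => if x ∈ X then 1 else 0
  have hzt : z (a, true) = 0 := by simp [z, ht]
  have hzf : z (a, false) = 1 := by simp [z, hf]
  have h1 : totalLength U = ∑ p : Position U, 1 := by
    rw [totalLength, ← Fin.sum_univ_fun_getElem, Fintype.sum_sigma]
    refine sum_congr rfl fun i _ => ?_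
    rw [cyclicLength_eq (hred _ (List.getElem_mem i.2))]
    simp
  have h2 : totalLength (U.map (whiteheadEquiv a z)) ≤ ∑ p : Position U,
      ((z (invLetter (letter (next.symm p))) - z (letter p)).natAbs +
        if (letter p).1 = a then 0 else 1) := by
    rw [totalLength, List.map_map, ← Fin.sum_univ_fun_getElem, Fintype.sum_sigma]
    refine sum_le_sum fun i _ => ?_
    exact cyclicLength_whiteheadHom_le hzt hzf _
  have h3 := (hmin (whiteheadEquiv a z)).trans h2
  have h4 : ∑ p : Position U, 1 = occurrences U a + ∑ p : Position U,
      if (letter p).1 = a then 0 else 1 := by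
    rw [← card_letter, card_filter, ← sum_add_distrib]
    refine sum_congr rfl fun p _ => ?_
    split <;> simp
  rw [h1, h4, sum_add_distrib] at h3
  refine (Nat.add_le_add_iff_right.1 h3).trans (le_of_eq ?_)
  rw [card_filter]
  refine sum_congr rfl fun p _ => ?_
  by_cases p1 : letter p ∈ X <;> by_cases p2 : invLetter (letter (next.symm p)) ∈ X <;>
    simp [z, p1, p2]

/-- A partition of the basis of a free group gives a free product decomposition. -/
theorem isInternalFreeProduct_closure {α : Type*} (s : Set α) :
    IsInternalFreeProduct (Subgroup.closure (FreeGroup.of '' s))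
      (Subgroup.closure (FreeGroup.of '' sᶜ)) := by
  classical
  set A := Subgroup.closure (FreeGroup.of '' s) with hA
  set B := Subgroup.closure (FreeGroup.of '' sᶜ) with hB
  have hmA : ∀ i ∈ s, FreeGroup.of i ∈ A := fun i hi => Subgroup.subset_closure ⟨i, hi, rfl⟩
  have hmB : ∀ i ∉ s, FreeGroup.of i ∈ B := fun i hi => Subgroup.subset_closure ⟨i, hi, rfl⟩
  let ψ : FreeGroup α →* Monoid.Coprod A B := FreeGroup.lift fun i =>
    if h : i ∈ s then Monoid.Coprod.inl ⟨_, hmA i h⟩ else Monoid.Coprod.inr ⟨_, hmB i h⟩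
  have hψA : ∀ x (hx : x ∈ A), ψ x = Monoid.Coprod.inl ⟨x, hx⟩ := by
    intro x hx
    induction hx using Subgroup.closure_induction with
    | mem x hx =>
      obtain ⟨i, hi, rfl⟩ := hx
      simp [ψ, hi]
    | one => rw [map_one]; exact (map_one _).symm
    | mul x y hx hy h1 h2 => rw [map_mul, h1, h2, ← map_mul]; rfl
    | inv x hx h => rw [map_inv, h, ← map_inv]; rfl
  have hψB : ∀ x (hx : x ∈ B), ψ x = Monoid.Coprod.inr ⟨x, hx⟩ := by
    intro x hx
    induction hx using Subgroup.closure_induction with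
    | mem x hx =>
      obtain ⟨i, hi, rfl⟩ := hx
      have hi : i ∉ s := hi
      simp [ψ, hi]
    | one => rw [map_one]; exact (map_one _).symm
    | mul x y hx hy h1 h2 => rw [map_mul, h1, h2, ← map_mul]; rfl
    | inv x hx h => rw [map_inv, h, ← map_inv]; rfl
  have h1 : ψ.comp (Monoid.Coprod.lift A.subtype B.subtype) = MonoidHom.id _ := by
    apply Monoid.Coprod.hom_ext
    · ext x; simp [hψA x.1 x.2]
    · ext x; simp [hψB x.1 x.2]
  have h2 : (Monoid.Coprod.lift A.subtype B.subtype).comp ψ = MonoidHom.id _ := by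
    ext i
    by_cases hi : i ∈ s <;> simp [ψ, hi]
  exact ⟨Function.LeftInverse.injective (g := ψ) fun x => DFunLike.congr_fun h1 x,
    Function.RightInverse.surjective (g := ψ) fun x => DFunLike.congr_fun h2 x⟩

open Position in
/-- The words of a diskbusting list are not all powers of generators. -/
theorem IsDiskbusting.exists_letter_next_ne (hn : 1 < n) {U : List (FreeGroup (Fin n))}
    (h : IsDiskbusting U) : ∃ p : Position U, letter (next p) ≠ letter p := by
  by_contra! hp
  -- If each letter is followed by itself, every word is a power of a letter, so splitting off one
  -- generator contradicts diskbusting.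
  let s : Set (Fin n) := {⟨0, by omega⟩}
  have hne : ∀ (t : Set (Fin n)) (i), i ∈ t → Subgroup.closure (FreeGroup.of '' t) ≠ ⊥ := by
    intro t i hi hbot
    have : FreeGroup.of i ∈ Subgroup.closure (FreeGroup.of '' t) :=
      Subgroup.subset_closure ⟨i, hi, rfl⟩
    rw [hbot, Subgroup.mem_bot] at this
    exact FreeGroup.of_ne_one i this
  refine h ⟨Subgroup.closure (FreeGroup.of '' s), Subgroup.closure (FreeGroup.of '' sᶜ),
    hne _ ⟨0, by omega⟩ rfl, hne _ ⟨1, hn⟩ (by simp [s]), isInternalFreeProduct_closure s,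
    fun u hu => ?_⟩
  obtain ⟨i, rfl⟩ := List.get_of_mem hu
  rcases Nat.eq_zero_or_pos (U.get i).toWord.length with h0 | h0
  · rw [List.length_eq_zero_iff, FreeGroup.toWord_eq_nil_iff] at h0
    rw [h0]
    exact Or.inl ⟨1, by simp⟩
  · let p : Position U := ⟨i, ⟨0, h0⟩⟩
    have hc : ∀ j, letter (next^[j] p) = letter p := by
      intro j
      induction j with
      | zero => rfl
      | succ j ih => rw [Function.iterate_succ_apply', hp, ih]
    have hL : (U.get i).toWord = List.replicate (U.get i).toWord.length (letter p) := by
      rw [List.eq_replicate_iff]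
      refine ⟨rfl, fun x hx => ?_⟩
      obtain ⟨t, ht, rfl⟩ := List.getElem_of_mem hx
      rw [← hc t, (letter_next_iterate p t).2.1]
      congr 1
      exact (Nat.mod_eq_of_lt ((zero_add t).symm ▸ ht)).symm ▸ (zero_add t).symm
    have hpow : ∀ m, FreeGroup.mk (List.replicate m (letter p)) = FreeGroup.mk [letter p] ^ m := by
      intro m
      induction m with
      | zero => rfl
      | succ m ih => rw [List.replicate_succ', ← FreeGroup.mul_mk, ih, pow_succ]
    have hu' : U.get i = FreeGroup.mk [letter p] ^ (U.get i).toWord.length := by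
      rw [← hpow, ← hL, FreeGroup.mk_toWord]
    have hmem : ∀ t : Set (Fin n), (letter p).1 ∈ t →
        U.get i ∈ Subgroup.closure (FreeGroup.of '' t) := by
      intro t ht
      rw [hu']
      refine pow_mem ?_ _
      generalize letter p = x at ht ⊢
      obtain ⟨c, b⟩ := x
      have : FreeGroup.of c ∈ Subgroup.closure (FreeGroup.of '' t) :=
        Subgroup.subset_closure ⟨c, ht, rfl⟩
      cases b
      · exact inv_mem this
      · exact this
    by_cases hs : (letter p).1 ∈ s
    · exact Or.inl ⟨1, by simpa using hmem s hs⟩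
    · exact Or.inr ⟨1, by simpa using hmem sᶜ hs⟩

end Polygonality

/-! ### Closed surfaces from combinatorial gluing data. -/

namespace Polygonality

/-- The cycles of a permutation of a finite type, as the boundary cycles of polygonal disks. -/
theorem exists_disks {T : Type} [Finite T] (N : Equiv.Perm T) :
    ∃ (P : Disks) (e : P.Side ≃ T), (∀ i j, e ⟨i, finRotate _ j⟩ = N (e ⟨i, j⟩)) ∧
      ∀ i, ∃ t, N^[P.sides i] t = t ∧ ∀ j, e ⟨i, j⟩ = N^[j] t := by
  obtain ⟨m, ⟨f⟩⟩ := Finite.exists_equiv_fin (Quotient (Equiv.Perm.SameCycle.setoid N))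
  let r : Fin m → T := fun i => (f.symm i).out
  have hr : ∀ i, (⟦r i⟧ : Quotient (Equiv.Perm.SameCycle.setoid N)) = f.symm i :=
    fun i => Quotient.out_eq _
  have hpos : ∀ i, 0 < Function.minimalPeriod N (r i) := fun i =>
    Function.minimalPeriod_pos_of_mem_periodicPts (N.injective.mem_periodicPts _)
  let P : Disks := ⟨m, fun i => Function.minimalPeriod N (r i), hpos⟩
  let g : P.Side → T := fun s => N^[s.2] (r s.1)
  have hpow : ∀ (j : ℕ) t, N^[j] t = (N ^ j) t := fun j t => by
    rw [Equiv.Perm.iterate_eq_pow]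
  have hsame : ∀ (j : ℕ) t, N.SameCycle t (N^[j] t) := fun j t => ⟨j, by
    rw [hpow, zpow_natCast]⟩
  have hg : Function.Bijective g := by
    constructor
    · rintro ⟨i, j⟩ ⟨i', j'⟩ h
      have hi : i = i' := by
        apply f.symm.injective
        rw [← hr, ← hr, Quotient.eq]
        have h1 := hsame j (r i)
        have h2 := hsame j' (r i')
        simp only [g] at h
        rw [h] at h1
        exact h1.trans h2.symm
      subst hi
      congr 1
      ext
      exact Function.iterate_injOn_Iio_minimalPeriod j.2 j'.2 h
    · intro t
      have h : N.SameCycle (r (f ⟦t⟧)) t := by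
        have := hr (f ⟦t⟧)
        rw [Equiv.symm_apply_apply, Quotient.eq] at this
        exact this
      obtain ⟨k, hk⟩ := h.exists_nat_pow_eq
      refine ⟨⟨f ⟦t⟧, ⟨k % _, Nat.mod_lt _ (hpos _)⟩⟩, ?_⟩
      simp only [g]
      rw [Function.iterate_mod_minimalPeriod_eq, hpow, hk]
  refine ⟨P, Equiv.ofBijective g hg, fun i j => ?_, fun i =>
    ⟨r i, Function.iterate_minimalPeriod, fun j => rfl⟩⟩
  have : NeZero (P.sides i) := ⟨(hpos i).ne'⟩
  simp only [Equiv.ofBijective_apply, g]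
  rw [finRotate_apply, ← Function.iterate_succ_apply' N, Fin.val_add, Fin.val_one',
    Nat.add_mod_mod]
  exact Function.iterate_mod_minimalPeriod_eq

/-- Half-sides of polygonal disks with the involutions that relate them: `flip` exchanges the two
ends of a side, `swap` glues, and `cross` exchanges the two half-sides at a corner. The half-sides
with `sgn` equal to `false` are the initial ends of the sides. -/
structure GluingData (n : ℕ) (ι : Type) where
  C : Type
  finite : Finite C
  sgn : C → Bool
  flip : C → C
  swap : C → C
  cross : C → C
  letter : C → Fin n × Bool
  label : C → Sym2 ι
  flip_flip : ∀ c, flip (flip c) = c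
  swap_swap : ∀ c, swap (swap c) = c
  cross_cross : ∀ c, cross (cross c) = c
  sgn_flip : ∀ c, sgn (flip c) = !sgn c
  sgn_cross : ∀ c, sgn (cross c) = !sgn c
  flip_swap : ∀ c, flip (swap c) = swap (flip c)
  swap_ne : ∀ c, swap c ≠ c
  cross_swap_ne : ∀ c, cross (swap c) ≠ c
  letter_flip : ∀ c, letter (flip c) = invLetter (letter c)
  letter_swap : ∀ c, letter (swap c) = letter c
  label_swap : ∀ c, label (swap c) = label c
  label_cross : ∀ c, label (cross c) = label c
  eq_or_eq_swap : ∀ c c', letter c = letter c' → label c = label c' → c' = c ∨ c' = swap c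

namespace GluingData

variable {n : ℕ} {ι : Type} (G : GluingData n ι)

instance : Finite G.C := G.finite

/-- The sides, represented by their initial ends. -/
abbrev Side : Type := {c : G.C // G.sgn c = false}

/-- The next side along the boundary of a disk. -/
def next : Equiv.Perm G.Side where
  toFun c := ⟨G.cross (G.flip c.1), by rw [G.sgn_cross, G.sgn_flip, c.2]; rfl⟩
  invFun c := ⟨G.flip (G.cross c.1), by rw [G.sgn_flip, G.sgn_cross, c.2]; rfl⟩
  left_inv c := by ext; simp [G.cross_cross, G.flip_flip]
  right_inv c := by ext; simp [G.cross_cross, G.flip_flip]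

/-- The initial end of a corner's outgoing side. -/
def corner (c : G.C) : G.Side :=
  if h : G.sgn c = false then ⟨c, h⟩ else ⟨G.cross c, by rw [G.sgn_cross]; simpa using h⟩

theorem corner_of_false {c : G.C} (h : G.sgn c = false) : G.corner c = ⟨c, h⟩ := dif_pos h

theorem corner_val (c : G.C) : (G.corner c).1 = c ∨ (G.corner c).1 = G.cross c := by
  unfold corner; split
  exacts [Or.inl rfl, Or.inr rfl]

theorem label_corner (c : G.C) : G.label (G.corner c).1 = G.label c := by
  rcases G.corner_val c with h | h <;> rw [h]
  exact G.label_cross c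

theorem corner_cross (c : G.Side) : G.corner (G.cross c.1) = c := by
  have : ¬ G.sgn (G.cross c.1) = false := by rw [G.sgn_cross, c.2]; simp
  unfold corner
  rw [dif_neg this]
  exact Subtype.ext (G.cross_cross _)

theorem eq_or_of_corner_eq {c c' : G.C} (h : G.corner c = G.corner c') :
    c = c' ∨ c = G.cross c' := by
  have h' := congrArg Subtype.val h
  rcases G.corner_val c with h1 | h1 <;> rcases G.corner_val c' with h2 | h2 <;> rw [h1, h2] at h'
  · exact Or.inl h'
  · exact Or.inr h'
  · right; rw [← h', G.cross_cross]
  · left; rw [← G.cross_cross c, h', G.cross_cross]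

/-- Half-sides are sides with a choice of an end. -/
def halfSide : G.Side × Bool ≃ G.C where
  toFun h := if h.2 then G.flip h.1.1 else h.1.1
  invFun c := if h : G.sgn c = false then (⟨c, h⟩, false) else
    (⟨G.flip c, by rw [G.sgn_flip]; simpa using h⟩, true)
  left_inv := by
    rintro ⟨⟨c, hc⟩, b⟩
    cases b
    · simp [hc]
    · simp [G.sgn_flip, hc, G.flip_flip]
  right_inv c := by
    by_cases h : G.sgn c = false <;> simp [h, G.flip_flip]

theorem halfSide_not (s : G.Side) (b : Bool) :
    G.halfSide (s, !b) = G.flip (G.halfSide (s, b)) := by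
  cases b <;> simp [halfSide, G.flip_flip]

theorem corner_halfSide (s : G.Side) (b : Bool) :
    G.corner (G.halfSide (s, b)) = if b then G.next s else s := by
  cases b
  · simp [halfSide, G.corner_of_false s.2]
  · have h : ¬ G.sgn (G.flip s.1) = false := by rw [G.sgn_flip, s.2]; simp
    simp [halfSide, corner, h, next]

variable {G} {P : Disks} (e : P.Side ≃ G.Side)

/-- The half-sides of the disks as elements of the gluing data. -/
def code : P.HalfSide ≃ G.C := (Equiv.prodCongr e (Equiv.refl Bool)).trans G.halfSide

theorem code_false (s : P.Side) : code e (s, false) = (e s).1 := rfl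

theorem code_not (s : P.Side) (b : Bool) : code e (s, !b) = G.flip (code e (s, b)) :=
  G.halfSide_not _ _

theorem code_true (s : P.Side) : code e (s, true) = G.flip (e s).1 := rfl

/-- Gluing commutes with exchanging the ends of a side, so it is determined by what it does at one
end. -/
theorem code_xor (s s' : P.Side) (b b' r : Bool) (h : code e (s', r) = G.swap (code e (s, b'))) :
    code e (s', xor b r) = G.swap (code e (s, xor b b')) := by
  cases b
  · simpa using h
  · simp only [Bool.true_xor]
    rw [code_not, code_not, h, G.flip_swap]

/-- The side-pairing given by `swap`. -/
def sidePairing : SidePairing P where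
  pair s := ((code e).symm (G.swap (e s).1)).1
  rev s := ((code e).symm (G.swap (e s).1)).2
  pair_pair s := by
    set h := (code e).symm (G.swap (e s).1) with hh
    have h1 : code e (h.1, h.2) = G.swap (code e (s, false)) := by
      rw [Prod.mk.eta, hh, Equiv.apply_symm_apply]; rfl
    have h2 := code_xor e s h.1 h.2 false h.2 h1
    have h3 : G.swap (e h.1).1 = code e (s, h.2) := by
      rw [Bool.xor_self, Bool.xor_false] at h2
      rw [← code_false, h2, G.swap_swap]
    rw [h3, Equiv.symm_apply_apply]
  rev_pair s := by
    set h := (code e).symm (G.swap (e s).1) with hh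
    have h1 : code e (h.1, h.2) = G.swap (code e (s, false)) := by
      rw [Prod.mk.eta, hh, Equiv.apply_symm_apply]; rfl
    have h2 := code_xor e s h.1 h.2 false h.2 h1
    have h3 : G.swap (e h.1).1 = code e (s, h.2) := by
      rw [Bool.xor_self, Bool.xor_false] at h2
      rw [← code_false, h2, G.swap_swap]
    rw [h3, Equiv.symm_apply_apply]
  pair_ne s hs := by
    set h := (code e).symm (G.swap (e s).1) with hh
    have h1 : code e (h.1, h.2) = G.swap (e s).1 := by
      rw [Prod.mk.eta, hh, Equiv.apply_symm_apply]
    rw [hs] at h1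
    cases hb : h.2 <;> rw [hb] at h1
    · exact G.swap_ne _ h1.symm
    -- A side glued to itself in reverse would read a letter equal to its own inverse.
    · rw [code_true] at h1
      have := congrArg G.letter h1
      rw [G.letter_flip, G.letter_swap] at this
      exact invLetter_ne _ this

theorem code_mate (h : P.HalfSide) : code e ((sidePairing e).mate h) = G.swap (code e h) := by
  obtain ⟨s, b⟩ := h
  have h1 : code e ((sidePairing e).pair s, (sidePairing e).rev s) = G.swap (code e (s, false)) := by
    simp only [sidePairing]
    rw [Prod.mk.eta, Equiv.apply_symm_apply]; rfl
  refine (code_xor e s _ b false _ h1).trans ?_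
  rw [Bool.xor_false]

/-- The map to the bouquet that is given by the letters. -/
def bouquetMap : BouquetMap n (sidePairing e) where
  letter s := G.letter (e s).1
  letter_pair s := by
    have h1 := code_mate e (s, false)
    have h2 : G.letter (code e ((sidePairing e).mate (s, false))) = G.letter (e s).1 := by
      rw [h1, G.letter_swap]; rfl
    simp only [SidePairing.mate, Bool.false_xor] at h2
    cases hr : (sidePairing e).rev s <;> rw [hr] at h2
    · rw [code_false] at h2
      simpa using h2
    · rw [code_true, G.letter_flip] at h2
      rw [← h2]; simp

theorem outgoing_bouquetMap (h : P.HalfSide) :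
    (bouquetMap e).outgoing h = G.letter (code e h) := by
  obtain ⟨s, b⟩ := h
  cases b
  · rfl
  · rw [code_true, G.letter_flip]; rfl

variable (hnext : ∀ i j, e ⟨i, finRotate _ j⟩ = G.next (e ⟨i, j⟩))
include hnext

theorem corner_code (h : P.HalfSide) : e h.corner = G.corner (code e h) := by
  obtain ⟨⟨i, j⟩, b⟩ := h
  refine Eq.trans ?_ (G.corner_halfSide _ _).symm
  cases b
  · rfl
  · exact hnext i j

/-- Labels are invariant under turning a corner and under gluing, so they descend to the vertices of
the surface; letter and label together determine a half-side up to gluing. -/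
theorem isImmersion_bouquetMap : (bouquetMap e).IsImmersion := by
  intro h h' hv ho
  have hlab : ∀ h : P.HalfSide, G.label (e h.corner).1 = G.label (code e h) := fun h => by
    rw [corner_code e hnext, label_corner]
  let Q : (sidePairing e).Vertex → Sym2 ι := Quot.lift (fun p => G.label (e p).1) (by
    rintro p q ⟨h, rfl, rfl⟩
    rw [hlab, hlab, code_mate, G.label_swap])
  have h1 : G.label (code e h) = G.label (code e h') := by
    rw [← hlab, ← hlab]
    exact congrArg Q hv
  rw [outgoing_bouquetMap, outgoing_bouquetMap] at ho
  rcases G.eq_or_eq_swap _ _ ho h1 with h2 | h2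
  · exact Or.inl ((code e).injective h2)
  · rw [← code_mate] at h2
    exact Or.inr ((code e).injective h2)

theorem mk_corner_swap (c : G.C) :
    (Quot.mk _ (e.symm (G.corner c)) : (sidePairing e).Vertex) =
      Quot.mk _ (e.symm (G.corner (G.swap c))) := by
  refine Quot.sound ⟨(code e).symm c, ?_, ?_⟩
  · rw [Equiv.eq_symm_apply, corner_code e hnext, Equiv.apply_symm_apply]
  · rw [Equiv.eq_symm_apply, corner_code e hnext, code_mate, Equiv.apply_symm_apply]

/-- Each edge comes from at most two sides. Each vertex has at least two corners, and the one
provided by `hstrict` has at least three. As there are as many corners as sides, V < E. -/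
theorem eulerChar_lt (hstrict : ∃ c, G.swap (G.cross c) ≠ G.cross (G.swap c)) :
    (sidePairing e).eulerChar < P.m := by
  classical
  set σ := sidePairing e with hσ
  let v : P.Side → σ.Vertex := Quot.mk _
  let ed : P.Side → σ.Edge := Quot.mk _
  have hv : Function.Surjective v := Quot.mk_surjective
  have hed : Function.Surjective ed := Quot.mk_surjective
  have : Finite σ.Vertex := Finite.of_surjective v hv
  have : Finite σ.Edge := Finite.of_surjective ed hed
  have := Fintype.ofFinite σ.Vertex
  have := Fintype.ofFinite σ.Edge
  have hpair : ∀ t s, Relation.EqvGen (fun s t => σ.pair s = t) t s → t = s ∨ t = σ.pair s := by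
    intro t s this
    induction this with
    | rel x y h => right; rw [← h, σ.pair_pair]
    | refl => exact Or.inl rfl
    | symm x y _ ih =>
      rcases ih with rfl | rfl
      · exact Or.inl rfl
      · right; rw [σ.pair_pair]
    | trans x y z _ _ h1 h2 =>
      rcases h1 with rfl | rfl <;> rcases h2 with rfl | rfl
      · exact Or.inl rfl
      · exact Or.inr rfl
      · exact Or.inr rfl
      · left; rw [σ.pair_pair]
  have hE : #(univ : Finset P.Side) ≤ 2 * Fintype.card σ.Edge := by
    rw [← card_univ]
    refine card_le_mul_card_image_of_maps_to (f := ed) (fun _ _ => mem_univ _) 2 fun y _ => ?_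
    obtain ⟨s, rfl⟩ := hed y
    refine (card_le_card (t := {s, σ.pair s}) ?_).trans card_le_two
    intro t ht
    have ht := (mem_filter.1 ht).2
    rw [mem_insert, mem_singleton]
    exact hpair _ _ (Quot.eqvGen_exact ht)
  have hmate : ∀ c : G.Side, v (e.symm (G.corner (G.swap c.1))) = v (e.symm c) := fun c => by
    have := mk_corner_swap e hnext c.1
    rw [G.corner_of_false c.2] at this
    exact this.symm
  have hmate' : ∀ c : G.Side, v (e.symm (G.corner (G.swap (G.cross c.1)))) = v (e.symm c) :=
    fun c => by
      have := mk_corner_swap e hnext (G.cross c.1)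
      rw [G.corner_cross] at this
      exact this.symm
  have hne1 : ∀ c : G.Side, G.corner (G.swap c.1) ≠ c := fun c h => by
    rcases G.corner_val (G.swap c.1) with h' | h' <;> rw [h] at h'
    · exact G.swap_ne _ h'.symm
    · exact G.cross_swap_ne _ h'.symm
  have hne2 : ∀ c : G.Side, G.corner (G.swap (G.cross c.1)) ≠ c := fun c h => by
    rcases G.corner_val (G.swap (G.cross c.1)) with h' | h' <;> rw [h] at h'
    · apply G.cross_swap_ne c.1
      conv_lhs => rw [h', G.swap_swap, G.cross_cross]
    · apply G.swap_ne (G.cross c.1)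
      conv_rhs => rw [h', G.cross_cross]
  obtain ⟨c₀, hc₀⟩ : ∃ c : G.Side, G.swap (G.cross c.1) ≠ G.cross (G.swap c.1) := by
    obtain ⟨c, hc⟩ := hstrict
    cases hs : G.sgn c
    · exact ⟨⟨c, hs⟩, hc⟩
    · refine ⟨⟨G.cross c, by rw [G.sgn_cross, hs]; rfl⟩, fun h => hc ?_⟩
      rw [← G.cross_cross (G.swap (G.cross c)), ← h, G.cross_cross]
  -- The corners reached by gluing across the two sides at `c₀` coincide only if `swap` and `cross`
  -- commute there; otherwise they are distinct and give a third corner.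
  have hne3 : G.corner (G.swap c₀.1) ≠ G.corner (G.swap (G.cross c₀.1)) := fun h => by
    rcases G.eq_or_of_corner_eq h with h | h
    · have := congrArg G.swap h
      rw [G.swap_swap, G.swap_swap] at this
      have h2 := congrArg G.sgn this
      rw [G.sgn_cross, c₀.2] at h2
      simp at h2
    · apply hc₀
      rw [h, G.cross_cross]
  have hV : Fintype.card σ.Vertex * 2 < #(univ : Finset P.Side) := by
    rw [card_eq_sum_card_fiberwise (f := v) (t := univ) (fun _ _ => by simp), ← card_univ,
      ← smul_eq_mul, ← sum_const]
    refine sum_lt_sum (fun y _ => ?_) ⟨v (e.symm c₀), mem_univ _, ?_⟩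
    · obtain ⟨s, rfl⟩ := hv y
      obtain ⟨c, rfl⟩ := e.symm.surjective s
      have h : #{e.symm c, e.symm (G.corner (G.swap c.1))} = 2 :=
        card_pair fun h => hne1 c (e.symm.injective h).symm
      rw [← h]
      refine card_le_card fun t ht => ?_
      rw [mem_insert, mem_singleton] at ht
      rw [mem_filter]
      rcases ht with rfl | rfl
      exacts [⟨mem_univ _, rfl⟩, ⟨mem_univ _, hmate c⟩]
    · have h : #{e.symm c₀, e.symm (G.corner (G.swap c₀.1)),
          e.symm (G.corner (G.swap (G.cross c₀.1)))} = 3 :=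
        card_eq_three.2 ⟨_, _, _, fun h => hne1 c₀ (e.symm.injective h).symm,
          fun h => hne2 c₀ (e.symm.injective h).symm, fun h => hne3 (e.symm.injective h), rfl⟩
      refine Nat.lt_of_lt_of_le (Nat.lt_succ_self 2) ?_
      rw [Nat.succ_eq_add_one, show 2 + 1 = 3 from rfl, ← h]
      refine card_le_card fun t ht => ?_
      rw [mem_insert, mem_insert, mem_singleton] at ht
      rw [mem_filter]
      rcases ht with rfl | rfl | rfl
      exacts [⟨mem_univ _, rfl⟩, ⟨mem_univ _, hmate c₀⟩, ⟨mem_univ _, hmate' c₀⟩]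
  unfold SidePairing.eulerChar
  rw [Nat.card_eq_fintype_card, Nat.card_eq_fintype_card]
  omega

end GluingData

end Polygonality

/-! ### The Whitehead graph and its fractional perfect matching. -/

namespace Polygonality

variable {n : ℕ} {U : List (FreeGroup (Fin n))}

/-- The half-sides of the polygons that read the words of the list: the position of a letter
together with one of the ends of the side that reads it. -/
abbrev Dart (U : List (FreeGroup (Fin n))) : Type := Position U × Bool

namespace Dart

/-- The letter read when a half-side is left from its base. -/
def out (d : Dart U) : Fin n × Bool :=
  if d.2 then invLetter (Position.letter d.1) else Position.letter d.1

/-- The other half of the same side. -/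
def flip (d : Dart U) : Dart U := (d.1, !d.2)

/-- The position that follows the corner of a half-side. -/
def corner (d : Dart U) : Position U := if d.2 then Position.next d.1 else d.1

/-- The other half-side at the same corner. -/
def cross (d : Dart U) : Dart U :=
  if d.2 then (Position.next d.1, false) else (Position.next.symm d.1, true)

@[simp] theorem flip_flip (d : Dart U) : flip (flip d) = d := by simp [flip]

@[simp] theorem cross_cross (d : Dart U) : cross (cross d) = d := by
  obtain ⟨p, b⟩ := d; cases b <;> simp [cross]

@[simp] theorem out_flip (d : Dart U) : out (flip d) = invLetter (out d) := by
  obtain ⟨p, b⟩ := d; cases b <;> simp [out, flip]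

@[simp] theorem corner_cross (d : Dart U) : corner (cross d) = corner d := by
  obtain ⟨p, b⟩ := d; cases b <;> simp [cross, corner]

theorem flip_snd (d : Dart U) : (flip d).2 = !d.2 := rfl

theorem cross_snd (d : Dart U) : (cross d).2 = !d.2 := by
  obtain ⟨p, b⟩ := d; cases b <;> simp [cross]

theorem eq_or_eq_cross {d d' : Dart U} (h : corner d = corner d') : d' = d ∨ d' = cross d := by
  obtain ⟨p, b⟩ := d
  obtain ⟨p', b'⟩ := d'
  cases b <;> cases b' <;> simp_all [corner, cross]

theorem out_cross_ne (hred : ∀ u ∈ U, FreeGroup.IsCyclicallyReduced u.toWord) (d : Dart U) :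
    out (cross d) ≠ out d := by
  obtain ⟨p, b⟩ := d
  cases b
  · have := Position.letter_next_ne hred (Position.next.symm p)
    rw [Equiv.apply_symm_apply] at this
    simpa [out, cross] using this.symm
  · simpa [out, cross] using Position.letter_next_ne hred p

/-- The end of an edge of the Whitehead graph at the incoming letter. -/
def inLetter (p : Position U) : Fin n × Bool :=
  invLetter (Position.letter (Position.next.symm p))

theorem out_cases (d : Dart U) :
    (out d = Position.letter (corner d) ∧ out (cross d) = inLetter (corner d)) ∨
    (out d = inLetter (corner d) ∧ out (cross d) = Position.letter (corner d)) := by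
  obtain ⟨p, b⟩ := d
  cases b
  · left; simp [out, corner, inLetter, cross]
  · right; simp [out, corner, inLetter, cross]

/-- Darts are the half-edges of the Whitehead graph: `corner` gives the edge and `out` the vertex.
Reducedness excludes loops. -/
theorem corner_mem_cut (hred : ∀ u ∈ U, FreeGroup.IsCyclicallyReduced u.toWord) (d : Dart U) :
    corner d ∈ Multigraph.cut Position.letter inLetter {out d} := by
  rw [Multigraph.mem_cut_singleton]
  have := out_cross_ne hred d
  rcases out_cases d with ⟨h1, h2⟩ | ⟨h1, h2⟩ <;> rw [h1, h2] at this <;> rw [h1]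
  exacts [⟨this.symm, Or.inl rfl⟩, ⟨this, Or.inr rfl⟩]

theorem exists_of_mem_cut {p : Position U} {x : Fin n × Bool}
    (h : p ∈ Multigraph.cut Position.letter inLetter {x}) : ∃ d, corner d = p ∧ out d = x := by
  rcases (Multigraph.mem_cut_singleton.1 h).2 with h | h
  · exact ⟨(p, false), rfl, h⟩
  · exact ⟨(Position.next.symm p, true), by simp [corner], h⟩

end Dart

open Position Dart

theorem letter_ne_inLetter (hred : ∀ u ∈ U, FreeGroup.IsCyclicallyReduced u.toWord)
    (p : Position U) : letter p ≠ inLetter p := by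
  have := letter_next_ne hred (next.symm p)
  rwa [Equiv.apply_symm_apply] at this

/-- An edge at `x` comes either from an occurrence of `x` or from the position after an occurrence
of `x⁻¹`. -/
theorem card_cut_singleton (hred : ∀ u ∈ U, FreeGroup.IsCyclicallyReduced u.toWord)
    (x : Fin n × Bool) :
    #(Multigraph.cut (letter (U := U)) inLetter {x}) = occurrences U x.1 := by
  have h1 : Multigraph.cut (letter (U := U)) inLetter {x} =
      ({p | letter p = x} : Finset _) ∪ ({p | inLetter p = x} : Finset _) := by
    ext p
    simp [Multigraph.mem_cut_singleton, letter_ne_inLetter hred]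
  have h2 : #{p : Position U | inLetter p = x} = #{p : Position U | letter p = invLetter x} := by
    refine card_bij (fun p _ => next.symm p) ?_ (fun _ _ _ _ h => next.symm.injective h) ?_
    · intro p hp
      simp only [mem_filter, mem_univ, true_and] at hp ⊢
      rw [← hp]; simp [inLetter]
    · intro p hp
      simp only [mem_filter, mem_univ, true_and] at hp
      exact ⟨next p, mem_filter.2 ⟨mem_univ _, by simp [inLetter, hp]⟩, by simp⟩
  rw [h1, card_union_of_disjoint, h2, ← card_letter, ← card_union_of_disjoint]
  · congr 1
    ext p
    obtain ⟨a, b⟩ := x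
    simp only [mem_union, mem_filter, mem_univ, true_and, invLetter, Prod.ext_iff]
    cases b <;> cases (letter p).2 <;> simp
  · rw [disjoint_filter]
    intro p _ h h'
    exact invLetter_ne x (h'.symm.trans h)
  · rw [disjoint_filter]
    intro p _ h h'
    exact letter_ne_inLetter hred p (h.trans h'.symm)

/-- Passing to the complement, which has the same cut, arranges that the set contains the inverse
and not the generator. -/
theorem le_card_cut {k : ℕ} (hred : ∀ u ∈ U, FreeGroup.IsCyclicallyReduced u.toWord)
    (hmin : IsMinimal U) (hreg : IsRegularList k U) {S : Finset (Fin n × Bool)} {x : Fin n × Bool}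
    (hx : ¬ (x ∈ S ↔ invLetter x ∈ S)) :
    k ≤ #(Multigraph.cut (letter (U := U)) inLetter S) := by
  have key : ∀ T : Finset (Fin n × Bool), (x.1, true) ∉ T → (x.1, false) ∈ T →
      k ≤ #(Multigraph.cut (letter (U := U)) inLetter T) := fun T h1 h2 => by
    rw [← hreg x.1]
    exact hmin.occurrences_le hred h1 h2
  obtain ⟨a, b⟩ := x
  by_cases h : (a, false) ∈ S
  · refine key S (fun h' => hx ?_) h
    cases b <;> simp [invLetter, h, h']
  · rw [← Multigraph.cut_compl]
    refine key Sᶜ (fun h' => hx ?_) (mem_compl.2 h)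
    rw [mem_compl] at h'
    cases b <;> simp [invLetter, h, h']

/-- Inversion has no fixed letter, so a set closed under it has even size. -/
theorem exists_separated_of_odd {S : Finset (Fin n × Bool)} (hS : Odd #S) :
    ∃ x, ¬ (x ∈ S ↔ invLetter x ∈ S) := by
  by_contra! h
  have h1 : #{x ∈ S | x.2 = true} = #{x ∈ S | ¬ x.2 = true} := by
    refine card_bij (fun x _ => invLetter x) ?_ ?_ ?_
    · intro x hx
      rw [mem_filter] at hx ⊢
      exact ⟨(h x).1 hx.1, by simp [invLetter, hx.2]⟩
    · intro x _ y _ hxy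
      rw [← invLetter_invLetter x, hxy, invLetter_invLetter]
    · intro x hx
      rw [mem_filter] at hx
      exact ⟨invLetter x, mem_filter.2 ⟨(h x).1 hx.1, by simpa [invLetter] using hx.2⟩, by simp⟩
  rw [← card_filter_add_card_filter_not (s := S) (fun x => x.2 = true), h1] at hS
  exact (Nat.not_even_iff_odd.2 hS) ⟨_, rfl⟩

theorem isFractional_whitehead {k : ℕ} (hk : 0 < k)
    (hred : ∀ u ∈ U, FreeGroup.IsCyclicallyReduced u.toWord)
    (hmin : IsMinimal U) (hreg : IsRegularList k U) :
    Multigraph.IsFractional (letter (U := U)) inLetter fun _ => (k : ℚ)⁻¹ where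
  nonneg _ := by positivity
  vertex x := by
    rw [sum_const, card_cut_singleton hred, hreg, nsmul_eq_mul]
    field_simp
  odd S hS := by
    obtain ⟨x, hx⟩ := exists_separated_of_odd hS
    have h := le_card_cut hred hmin hreg hx
    rw [sum_const, nsmul_eq_mul, ← div_eq_mul_inv, one_le_div (by positivity)]
    exact_mod_cast h

/-! ### Matching families and the surface they define. -/

/-- A family of perfect matchings of the Whitehead graph, given by the half-edge `m i x` of the
`i`-th matching at `x`, with permutations of the family that are compatible with the sides. -/
structure MatchingFamily (U : List (FreeGroup (Fin n))) where
  ι : Type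
  finite : Finite ι
  m : ι → Fin n × Bool → Dart U
  perm : Fin n × Bool → ι → ι
  out_m : ∀ i x, out (m i x) = x
  m_cross : ∀ i x, m i (out (cross (m i x))) = cross (m i x)
  m_perm : ∀ i x, m (perm x i) (invLetter x) = flip (m i x)
  perm_perm : ∀ i x, perm (invLetter x) (perm x i) = i
  exists_m : ∀ d, ∃ i, m i (out d) = d

/-- As the weight is constant, all edges lie in equally many matchings. So the darts used at `a`,
once flipped, have the same distribution as those used at `a⁻¹`, which yields the permutations; the
common count is positive, so every dart is used. -/
theorem nonempty_matchingFamily {k : ℕ} (hk : 0 < k)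
    (hred : ∀ u ∈ U, FreeGroup.IsCyclicallyReduced u.toWord)
    (hmin : IsMinimal U) (hreg : IsRegularList k U) : Nonempty (MatchingFamily U) := by
  obtain ⟨ι, _, _, M, hM, hc⟩ := (isFractional_whitehead hk hred hmin hreg).isDecomposable
  have hex : ∀ i x, ∃ d : Dart U, corner d ∈ M i ∧ out d = x := by
    intro i x
    obtain ⟨p, hp⟩ := card_eq_one.1 ((hM i).card_vertex x)
    have hp' : p ∈ M i ∩ Multigraph.cut letter inLetter {x} := by rw [hp]; simp
    obtain ⟨d, rfl, hd⟩ := exists_of_mem_cut (mem_inter.1 hp').2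
    exact ⟨d, (mem_inter.1 hp').1, hd⟩
  choose m hm hout using hex
  have huniq : ∀ i d, corner d ∈ M i → m i (out d) = d := by
    intro i d hd
    have h1 := card_le_one.1 ((hM i).card_vertex (out d)).le
    have h2 := corner_mem_cut hred (m i (out d))
    rw [hout] at h2
    have h3 := h1 _ (mem_inter.2 ⟨hm i (out d), h2⟩) _ (mem_inter.2 ⟨hd, corner_mem_cut hred d⟩)
    rcases eq_or_eq_cross h3.symm with h | h
    · exact h
    · exact absurd (by rw [← h, hout]) (out_cross_ne hred d)
  have hiff : ∀ i d, m i (out d) = d ↔ corner d ∈ M i := fun i d =>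
    ⟨fun h => by rw [← h]; exact hm _ _, huniq i d⟩
  have hcount : ∀ d d' : Dart U, #{i | m i (out d) = d} = #{i | m i (out d') = d'} := by
    intro d d'
    simp only [hiff]
    have := (hc _ (letter_ne_inLetter hred (corner d))).trans
      (hc _ (letter_ne_inLetter hred (corner d'))).symm
    exact_mod_cast this
  have hperm : ∀ a : Fin n, ∃ π : Equiv.Perm ι, ∀ i, m (π i) (a, false) = flip (m i (a, true)) := by
    intro a
    refine exists_perm_comp_eq (fun i => flip (m i (a, true))) (fun i => m i (a, false)) fun d => ?_
    by_cases hd : out d = (a, false)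
    · have h1 : out (flip d) = (a, true) := by rw [out_flip, hd]; rfl
      have h2 := hcount (flip d) d
      rw [h1, hd] at h2
      rw [← h2]
      congr 1
      ext i
      simp only [mem_filter, mem_univ, true_and]
      exact ⟨fun h => by rw [← h, Dart.flip_flip], fun h => by rw [h, Dart.flip_flip]⟩
    · rw [filter_false_of_mem, filter_false_of_mem]
      · rintro i - rfl; exact hd (hout _ _)
      · rintro i - rfl; exact hd (by rw [out_flip, hout]; rfl)
  choose π hπ using hperm
  refine ⟨⟨ι, inferInstance, m, fun x => if x.2 then π x.1 else (π x.1).symm, hout, fun i x => ?_,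
    fun i x => ?_, fun i x => ?_, fun d => ?_⟩⟩
  · exact huniq i _ (by rw [corner_cross]; exact hm i x)
  · obtain ⟨a, b⟩ := x
    cases b
    · have := hπ a ((π a).symm i)
      rw [Equiv.apply_symm_apply] at this
      simp [this, invLetter]
    · exact hπ a i
  · obtain ⟨a, b⟩ := x
    cases b <;> simp [invLetter]
  · obtain ⟨i⟩ := ‹Nonempty ι›
    have h : 0 < #{i | m i (out d) = d} := by
      rw [← hcount (m i (out d)) d, hout]
      exact card_pos.2 ⟨i, by simp⟩
    obtain ⟨j, hj⟩ := card_pos.1 h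
    exact ⟨j, (mem_filter.1 hj).2⟩

namespace MatchingFamily

variable (F : MatchingFamily U)

/-- This and the next lemma show that two matchings which differ at a letter still differ after
passing to the other end of a side or around a corner. -/
theorem m_injective {i j : F.ι} {x : Fin n × Bool}
    (h : F.m (F.perm x i) (invLetter x) = F.m (F.perm x j) (invLetter x)) : F.m i x = F.m j x := by
  rw [F.m_perm, F.m_perm] at h
  rw [← flip_flip (F.m i x), h, Dart.flip_flip]

theorem m_cross_injective {i j : F.ι} {x : Fin n × Bool}
    (h : F.m i (out (cross (F.m i x))) = F.m j (out (cross (F.m i x)))) : F.m i x = F.m j x := by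
  have h1 := F.m_cross j (out (cross (F.m i x)))
  rw [← h, F.m_cross, cross_cross, F.out_m] at h1
  exact h1.symm

/-- Pairs of matchings that differ at a letter, as half-sides of polygonal disks: they run around
the cycles formed by the two matchings. -/
def gluingData : GluingData n F.ι where
  C := {c : (Fin n × Bool) × F.ι × F.ι // F.m c.2.1 c.1 ≠ F.m c.2.2 c.1}
  finite := by
    have := F.finite
    infer_instance
  sgn c := (F.m c.1.2.1 c.1.1).2
  flip c := ⟨(invLetter c.1.1, F.perm c.1.1 c.1.2.1, F.perm c.1.1 c.1.2.2),
    fun h => c.2 (F.m_injective h)⟩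
  swap c := ⟨(c.1.1, c.1.2.2, c.1.2.1), c.2.symm⟩
  cross c := ⟨(out (cross (F.m c.1.2.1 c.1.1)), c.1.2.1, c.1.2.2),
    fun h => c.2 (F.m_cross_injective h)⟩
  letter c := c.1.1
  label c := s(c.1.2.1, c.1.2.2)
  flip_flip c := by
    obtain ⟨⟨x, i, j⟩, h⟩ := c
    simp [F.perm_perm]
  swap_swap c := rfl
  cross_cross c := by
    obtain ⟨⟨x, i, j⟩, h⟩ := c
    simp [F.m_cross, F.out_m]
  sgn_flip c := by
    obtain ⟨⟨x, i, j⟩, h⟩ := c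
    simp only [F.m_perm, flip_snd]
  sgn_cross c := by
    obtain ⟨⟨x, i, j⟩, h⟩ := c
    simp only [F.m_cross, cross_snd]
  flip_swap c := rfl
  swap_ne c h := by
    have := congrArg (fun c => c.1.2.1) h
    exact c.2 (by dsimp only at this; rw [this])
  cross_swap_ne c h := by
    have := congrArg (fun c => c.1.2.1) h
    exact c.2 (by dsimp only at this; rw [this])
  letter_flip c := rfl
  letter_swap c := rfl
  label_swap c := Sym2.eq_swap
  label_cross c := rfl
  eq_or_eq_swap c c' h h' := by
    obtain ⟨⟨x, i, j⟩, hc⟩ := c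
    obtain ⟨⟨x', i', j'⟩, hc'⟩ := c'
    dsimp only at h h'
    subst h
    rcases Sym2.eq_iff.1 h' with ⟨rfl, rfl⟩ | ⟨rfl, rfl⟩
    exacts [Or.inl rfl, Or.inr rfl]

/-- The position of the letter that is read along a side. -/
def position (s : F.gluingData.Side) : Position U := (F.m s.1.1.2.1 s.1.1.1).1

theorem m_eq (s : F.gluingData.Side) : F.m s.1.1.2.1 s.1.1.1 = (F.position s, false) :=
  Prod.ext rfl s.2

theorem letter_position (s : F.gluingData.Side) :
    letter (F.position s) = F.gluingData.letter s.1 := by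
  have := F.out_m s.1.1.2.1 s.1.1.1
  rw [m_eq] at this
  exact this

/-- The permutation leads to the terminal end of the same position, and the matching `i` then leads
around the corner to the start of the next letter. The second matching has no influence on what is
read. -/
theorem position_next (s : F.gluingData.Side) :
    F.position (F.gluingData.next s) = next (F.position s) := by
  have h : F.m (F.perm s.1.1.1 s.1.1.2.1) (invLetter s.1.1.1) = (F.position s, true) := by
    rw [F.m_perm, m_eq]; rfl
  change (F.m (F.perm s.1.1.1 s.1.1.2.1) (out (cross (F.m (F.perm s.1.1.1 s.1.1.2.1)
    (invLetter s.1.1.1))))).1 = _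
  rw [F.m_cross, h]
  rfl

theorem position_next_iterate (s : F.gluingData.Side) (j : ℕ) :
    F.position (F.gluingData.next^[j] s) = next^[j] (F.position s) := by
  induction j with
  | zero => rfl
  | succ j ih => rw [Function.iterate_succ_apply', Function.iterate_succ_apply', position_next, ih]

/-- If `swap` and `cross` always commute, all matchings give a letter the same partner. As every
edge is in some matching, a letter and its partner form a union of components. At `p` the partner is
not the inverse, so this set separates a letter from its inverse with an empty cut, although at
least `k > 0` edges must leave it. -/
theorem exists_not_commute {k : ℕ} (hk : 0 < k)
    (hred : ∀ u ∈ U, FreeGroup.IsCyclicallyReduced u.toWord) (hmin : IsMinimal U)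
    (hreg : IsRegularList k U) {p : Position U} (hp : letter (next p) ≠ letter p) :
    ∃ c, F.gluingData.swap (F.gluingData.cross c) ≠ F.gluingData.cross (F.gluingData.swap c) := by
  by_contra! hcon
  have h1 : ∀ x i j, out (cross (F.m i x)) = out (cross (F.m j x)) := by
    intro x i j
    by_cases h : F.m i x = F.m j x
    · rw [h]
    · exact congrArg (fun c => c.1.1) (hcon ⟨(x, i, j), h⟩)
  have h2 : ∀ d d' : Dart U, out d = out d' → out (cross d) = out (cross d') := by
    intro d d' h
    obtain ⟨i, hi⟩ := F.exists_m d
    obtain ⟨j, hj⟩ := F.exists_m d'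
    rw [← hi, ← hj, h]
    exact h1 _ i j
  let d : Dart U := (p, true)
  have hd : out (cross d) ≠ invLetter (out d) := by simpa [d, out, cross] using hp
  have hcut : Multigraph.cut (letter (U := U)) inLetter {out d, out (cross d)} = ∅ := by
    ext q
    rw [Multigraph.mem_cut]
    simp only [mem_insert, mem_singleton, notMem_empty, iff_false, not_not]
    have e1 : letter q = out ((q, false) : Dart U) := rfl
    have e2 : inLetter q = out (cross (q, false) : Dart U) := rfl
    rw [e1, e2]
    generalize ((q, false) : Dart U) = d'
    constructor
    · rintro (h | h)
      · exact Or.inr (h2 _ _ h)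
      · left; rw [h2 _ _ h, cross_cross]
    · rintro (h | h)
      · right; rw [← h2 _ _ h, cross_cross]
      · left; simpa using h2 _ _ h
  have := le_card_cut (S := {out d, out (cross d)}) (x := out d) hred hmin hreg (by
    simp only [mem_insert, mem_singleton, true_or, true_iff, not_or]
    exact ⟨invLetter_ne _, hd.symm⟩)
  rw [hcut, card_empty] at this
  omega

end MatchingFamily

/-! ### Boundary words as powers, and the conclusion. -/

theorem getElem_flatten_replicate {α : Type*} (L : List α) (c t : ℕ)
    (h : t < (List.replicate c L).flatten.length) :
    (List.replicate c L).flatten[t] = L[t % L.length]'(Nat.mod_lt _ (by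
      by_contra hL; simp at hL; simp [hL] at h)) := by
  induction c generalizing t with
  | zero => simp at h
  | succ c ih =>
    simp only [List.replicate_succ, List.flatten_cons, List.getElem_append]
    split
    · simp [Nat.mod_eq_of_lt ‹_›]
    · rw [ih]
      congr 1
      exact (Nat.mod_eq_sub_mod (by omega)).symm

/-- A word that runs around a cyclically reduced word several times is a power of it, up to
rotation. -/
theorem isRotated_pow {u : FreeGroup (Fin n)} (hu : FreeGroup.IsCyclicallyReduced u.toWord)
    {N r : ℕ} (hN : 0 < N) (hdvd : u.toWord.length ∣ N) (g : Fin N → Fin n × Bool)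
    (hg : ∀ j : Fin N, u.toWord[(r + j) % u.toWord.length]? = some (g j)) :
    ∃ c : ℤ, c ≠ 0 ∧ (List.ofFn g).IsRotated (u ^ c).toWord := by
  obtain ⟨c, rfl⟩ := hdvd
  refine ⟨c, by rintro h; simp_all, ?_⟩
  rw [zpow_natCast, FreeGroup.toWord_pow, (hu.flatten_replicate c).isReduced.reduce_eq]
  refine List.IsRotated.symm ⟨r, List.ext_getElem (by simp [mul_comm]) fun t h1 h2 => ?_⟩
  have h3 := hg ⟨t, by simpa using h2⟩
  rw [List.getElem_ofFn, List.getElem_rotate, getElem_flatten_replicate]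
  rw [List.getElem?_eq_some_iff] at h3
  obtain ⟨_, h3⟩ := h3
  rw [← h3]
  congr 1
  have : (List.replicate c u.toWord).flatten.length = u.toWord.length * c := by simp [mul_comm]
  rw [this, Nat.mod_mul_right_mod, add_comm]

end Polygonality

/-- A minimal, diskbusting, `k`-regular list of cyclically reduced words in `F_n`, `n > 1`, is
polygonal. -/
theorem mainTheorem6 (n : ℕ) (hn : 1 < n) (k : ℕ) (U : List (FreeGroup (Fin n)))
    (hred : ∀ u ∈ U, FreeGroup.IsCyclicallyReduced u.toWord)
    (hmin : Polygonality.IsMinimal U)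
    (hdisk : Polygonality.IsDiskbusting U)
    (hreg : Polygonality.IsRegularList k U) :
    Polygonality.IsPolygonal U := by
  obtain ⟨p, hp⟩ := hdisk.exists_letter_next_ne hn
  have hk : 0 < k := by
    rw [← hreg (Polygonality.Position.letter p).1, ← Polygonality.Position.card_letter]
    exact Finset.card_pos.2 ⟨p, by simp⟩
  obtain ⟨F⟩ := Polygonality.nonempty_matchingFamily hk hred hmin hreg
  obtain ⟨P, e, hnext, horbit⟩ := Polygonality.exists_disks F.gluingData.next
  refine ⟨P, _, Polygonality.GluingData.bouquetMap e,
    Polygonality.GluingData.isImmersion_bouquetMap e hnext, fun i => ?_,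
    Polygonality.GluingData.eulerChar_lt e hnext (F.exists_not_commute hk hred hmin hreg hp)⟩
  obtain ⟨t, ht, hj⟩ := horbit i
  refine ⟨U.get (F.position t).1, List.get_mem _ _, ?_⟩
  -- Once around the disk the position returns to itself, so the number of sides is a multiple of
  -- the length of the word.
  have hper := F.position_next_iterate t (P.sides i)
  rw [ht] at hper
  refine Polygonality.isRotated_pow (r := (F.position t).2) (hred _ (List.get_mem _ _))
    (P.sides_pos i) (((F.position t).letter_next_iterate _).2.2.1 hper.symm) _ fun j => ?_
  have h1 : (Polygonality.GluingData.bouquetMap e).letter ⟨i, j⟩ =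
      Polygonality.Position.letter (Polygonality.Position.next^[j] (F.position t)) := by
    rw [← F.position_next_iterate, F.letter_position, ← hj]
    rfl
  rw [h1, ((F.position t).letter_next_iterate j).2.1]
  exact List.getElem?_eq_getElem _
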